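/- **State Transition Type Safety (act language).** Let $\Sigma$ be a well-typed state typing and let $s, s'$ be states with $\Sigma\vdash s\rightsquigarrow^* s'$ (zero or more constructor or transition steps). Then - for all values $v$ and slot types $\sigma$: if $\Sigma\vdash v:_s\sigma$ then $\Sigma\vdash v:_{s'}\sigma$; - $\mathrm{dom}(s)\subseteq\mathrm{dom}(s')$. The state $s$ is arbitrary; it need not be reachable from the empty state. The notions used are the following. *Types.* Integer types $\iota$: $\mathtt{uint}M$, $\mathtt{int}M$ ($M\in\{8,16,\dots,256\}$) and the unbounded $\mathtt{int}$. Base types $\beta::=\iota\mid\mathtt{bool}\mid\mathtt{address}$; mapping types $\mu::=\mathtt{mapping}(\beta,\mu)\mid\beta$; ABI types $\alpha::=\beta\mid\mathtt{address}_A$; slot types $\sigma::=\mu\mid\alpha\mid A$, where $A$ is a contract name. *Values and states.* $\mathrm{Addr}=\mathbb N$. Base values are the elements of $\mathbb Z+\mathbb B+\mathrm{Addr}$; values are base values and functions from $\mathbb Z$, $\mathbb B$ or $\mathrm{Addr}$ to values. A state is a finite partial map sending an address $\ell$ to a contract type $s(\ell).\mathtt{type}$ and a partial map $x\mapsto s(\ell)(x)$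 from field names to values. An environment $\rho$ is a partial map from identifiers and the keywords $\mathtt{caller},\mathtt{origin},\mathtt{callvalue}$ (which are not identifiers) to base values. *State typings.* $\Sigma$ assigns to contract names $A$ (partially) a storage typing $\Sigma_{\rm Storage}(A)$, i.e. a partial map from fields to slot types, a constructor $\Sigma_{\rm Cnstr}(A)$ and a list of transitions $\Sigma_{\rm Trans}(A)$. A constructor has an interface $I=(x_1:\alpha_1,\dots,x_n:\alpha_n)$, preconditions, and a nonempty list of cases, each a condition with a list of assignments $\sigma\;x:=se$; a transition has an interface, preconditions, and cases, each a condition with a list of updates $\mathit{ref}:=se$ and an optional return expression. Both also have postconditions and a payable flag. *Value typing.* $\vdash v:\beta$ says that $v$ is an address, a boolean, or an integer in the range of $\iota$; $\vdash f:\mathtt{mapping}(\beta,\mu)$ says that $f$ is a function on the domain of $\beta$ ($\mathbb Z$, $\mathbb B$ or $\mathrm{Addr}$) with $\vdash f(v):\mu$ whenever $\vdash v:\beta$. $\Sigma\vdash v:_s\sigma$ is the least relation such that: $\Sigma\vdash v:_s\mu$ if $\vdash v:\mu$; $\Sigma\vdash\ell:_s\mathtt{address}_A$ if $\ell\in\mathrm{dom}(s)$,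 $A\in\mathrm{dom}(\Sigma_{\rm Storage})$, $s(\ell).\mathtt{type}=A$, the fields of $s(\ell)$ are exactly those of $\Sigma_{\rm Storage}(A)$, and $\Sigma\vdash s(\ell)(x):_s\Sigma_{\rm Storage}(A)(x)$ for every such field $x$; $\Sigma\vdash\ell:_s A$ if $\Sigma\vdash\ell:_s\mathtt{address}_A$. $\Sigma\vdash\rho:_sI$ says that $\rho$ is defined exactly on the variables of $I$ and the three keywords, its values at the variables have their types in $I$, and $\mathtt{caller},\mathtt{origin}$ have type $\mathtt{address}$, $\mathtt{callvalue}$ type $\mathtt{uint256}$. *Steps.* $\Sigma\vdash s\rightsquigarrow s'$ holds if, for some $A,\ell,\rho$, either (constructor) $\Sigma_{\rm Cnstr}(A)=c$, $\Sigma\vdash\rho:_s I_c$ and $s;\rho;c\Downarrow_A(\ell,s')$; or (transition) $\Sigma\vdash\ell:_sA$, $t\in\Sigma_{\rm Trans}(A)$, $\Sigma\vdash\rho:_sI_t$ and $s;\rho;t\Downarrow_\ell(v,s')$ for some $v$. Here $\Downarrow$ is the big-step pointer semantics of act: all preconditions evaluate to true, exactly one case condition evaluates to true and the others to false, and the body of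 that case is executed. The body of a constructor case evaluates its slot expressions from left to right, threading the state, and allocates at $\max(\mathrm{dom})+1$ an instance of type $A$ with the resulting values; constructor code runs at a dummy location (address $0$). The body of a transition case evaluates all right-hand sides from left to right, then performs the field assignments one after the other (each reference being evaluated in the then current state), and evaluates the return expression, if any, in the pair (pre-state, post-state). Slot expressions are mapping expressions, references, $\mathrm{addr}(se)$, and $\mathtt{new}\,A(\dots)$ or $\mathtt{new}\,A\{\mathtt{value}:se\}(\dots)$, which run the cases of the constructor $\Sigma_{\rm Cnstr}(A)$ with the evaluated arguments, the current location as caller, the same origin, and call value $0$ or the given value. *Well-typed $\Sigma$.* The least predicate such that $\Sigma$ is well-typed if $\mathrm{dom}(\Sigma_{\rm Storage})=\mathrm{dom}(\Sigma_{\rm Cnstr})$; for each $A\in\mathrm{dom}(\Sigma_{\rm Cnstr})$ there is a well-typed $\Sigma'\subsetneq\Sigma$ with $\Sigma'\vdash_A\Sigma_{\rm Cnstr}(A):\Sigma_{\rm Storage}(A)$; and for each $A\in\mathrm{dom}(\Sigma_{\rm Trans})$ there is a well-typed $\Sigma'\subsetneq\Sigma$ with $\Sigma'\vdash_At$ for all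 $t\in\Sigma_{\rm Trans}(A)$. These are the typing judgments of act for constructors and transitions: interface types are well-formed (refer only to contracts of $\Sigma'$); preconditions, case conditions and postconditions are boolean; the preconditions entail that exactly one case condition holds; each constructor case creates precisely the fields of the storage typing, disjoint from the interface variables, with well-formed types and including $\mathtt{balance}:\mathtt{uint256}$, each from a slot expression of the declared type; each update assigns a slot expression of type $\sigma$ to a reference of type $\sigma$ that is reachable from the contract's own storage by field accesses without coercion, and no update is preceded by one of a strictly more specific reference; return expressions have the return type. Slot expressions are typed assuming the preconditions and the condition of their case; the typing of integer operations and conversions, and of $\mathtt{new}$, requires range conditions and constructor preconditions, respectively, to hold in every configuration $(s,\rho,\ell)$ that is well-typed under $\Sigma'$ and satisfies these assumptions. -/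

import Mathlib

namespace Act

/-! ### Identifiers, types, values, states -/

/-- Names of variables, of storage fields and of contracts. -/
abbrev Ident := String

/-- The reserved field name `balance`, written through its character codes. -/
def balanceName : Ident := String.ofList ([98, 97, 108, 97, 110, 99, 101].map Char.ofNat)

/-- Bit widths `8, 16, …, 256`. -/
def Width := {m : ℕ // ∃ i : ℕ, 1 ≤ i ∧ i ≤ 32 ∧ m = i * 8}

/-- Integer types: `uintM`, `intM` and the unbounded type `int`. -/
inductive IntType
  | uint (M : Width)
  | sint (M : Width)
  | unbounded

inductive BaseType
  | int (ι : IntType)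
  | bool
  | address

def BaseType.uint256 : BaseType := .int (.uint ⟨256, 32, by norm_num, by norm_num, by norm_num⟩)

inductive MapType
  | base (β : BaseType)
  | mapping (β : BaseType) (μ : MapType)

/-- ABI types: a base type or `address_A`. -/
inductive ABIType
  | base (β : BaseType)
  | contractAddr (A : Ident)

/-- Slot types: mapping types `μ`, ABI types `α`, and contract types `A`. A base type is both a
mapping type and an ABI type; it has the single representation `map (base β)`. -/
inductive SlotType
  | map (μ : MapType)
  | contractAddr (A : Ident)
  | contract (A : Ident)

def ABIType.toSlot : ABIType → SlotType
  | .base β => .map (.base β)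
  | .contractAddr A => .contractAddr A

abbrev Addr := ℕ

inductive BaseValue
  | int (n : ℤ)
  | bool (b : Bool)
  | addr (l : Addr)
  deriving DecidableEq

inductive Value
  | base (b : BaseValue)
  | mapInt (f : ℤ → Value)
  | mapBool (f : Bool → Value)
  | mapAddr (f : Addr → Value)

/-- A contract instance: its contract type and its storage. -/
structure Obj where
  type : Ident
  store : Ident → Option Value

/-- States: partial maps from addresses to contract instances, of finite domain. -/
abbrev State := Finmap (fun _ : Addr => Obj)

/-- `fresh s = max (dom s) + 1`, with `max ∅ = 0`. -/
def fresh (s : State) : Addr := s.keys.sup id + 1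

/-- The keys of an environment: identifiers and the three keywords, which are not identifiers. -/
inductive EnvKey
  | var (x : Ident)
  | caller
  | origin
  | callvalue

abbrev Env := EnvKey → Option BaseValue

/-- `v` lies in the integer type `ι`. -/
def IntType.InRange : IntType → ℤ → Prop
  | .uint M, v => 0 ≤ v ∧ v ≤ 2 ^ M.val - 1
  | .sint M, v => -2 ^ (M.val - 1) ≤ v ∧ v ≤ 2 ^ (M.val - 1) - 1
  | .unbounded, _ => True

/-- Membership of a base value in `meta β`, which is `ℤ`, `𝔹` or `Addr`. -/
def BaseValue.InMeta : BaseType → BaseValue → Prop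
  | .int _, .int _ => True
  | .bool, .bool _ => True
  | .address, .addr _ => True
  | _, _ => False

/-- `v ∈ meta β → Value`. -/
def Value.IsMap : BaseType → Value → Prop
  | .int _, .mapInt _ => True
  | .bool, .mapBool _ => True
  | .address, .mapAddr _ => True
  | _, _ => False

/-- Application of a mapping value to a key, defined when the key lies in its domain. -/
def Value.app : Value → BaseValue → Option Value
  | .mapInt f, .int n => some (f n)
  | .mapBool f, .bool b => some (f b)
  | .mapAddr f, .addr l => some (f l)
  | _, _ => none

/-- The restriction of `f` to `meta β`, as a mapping value. -/
def Value.ofFun : BaseType → (BaseValue → Value) → Value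
  | .int _, f => .mapInt fun n => f (.int n)
  | .bool, f => .mapBool fun b => f (.bool b)
  | .address, f => .mapAddr fun l => f (.addr l)

def defaultValue : MapType → Value
  | .base (.int _) => .base (.int 0)
  | .base .bool => .base (.bool false)
  | .base .address => .base (.addr 0)
  | .mapping β μ => .ofFun β fun _ => defaultValue μ

/-! ### Syntax -/

inductive IntOp
  | add | sub | mul | div | mod | exp

inductive BoolOp
  | and | or | imp

inductive CmpOp
  | lt | le | ge | gt

inductive EnvVar
  | caller | origin | callvalue | this

mutual

/-- Variable references. -/
inductive Ref
  | var (x : Ident)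
  | pre (x : Ident)
  | post (x : Ident)
  | coerce (r : Ref) (A : Ident)
  | field (r : Ref) (x : Ident)
  | index (r : Ref) (e : Expr)
  | env (v : EnvVar)

/-- Base expressions. References carry their type annotation. -/
inductive Expr
  | int (n : ℤ)
  | bool (b : Bool)
  | ref (r : Ref) (α : ABIType)
  | addr (r : Ref) (A : Ident)
  | iop (op : IntOp) (e₁ e₂ : Expr)
  | bop (op : BoolOp) (e₁ e₂ : Expr)
  | cmp (op : CmpOp) (e₁ e₂ : Expr)
  | not (e : Expr)
  | inrange (ι : IntType) (e : Expr)
  | ite (e₁ e₂ e₃ : Expr)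
  | eq (e₁ e₂ : Expr)

end

/-- Mapping expressions. The annotations `β`, `μ` stand for the type `mapping(β, μ)`. -/
inductive MapExpr
  | exp (e : Expr)
  | map (kvs : List (Expr × MapExpr)) (β : BaseType) (μ : MapType)
  | upd (r : Ref) (kvs : List (Expr × MapExpr)) (β : BaseType) (μ : MapType)

/-- Slot expressions. `new A ses` and `newPayable A se ses` are `new A(ses)` and
`new A{value: se}(ses)`. -/
inductive SlotExpr
  | map (m : MapExpr)
  | new (A : Ident) (ses : List SlotExpr)
  | newPayable (A : Ident) (val : SlotExpr) (ses : List SlotExpr)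
  | ref (r : Ref) (A : Ident)
  | addr (se : SlotExpr)

/-- Interfaces `x₁ : α₁, …, xₙ : αₙ`; as a map, `I(x)` is `I.lookup x`. -/
abbrev Iface := List (Ident × ABIType)

/-- `σ x := se` in a constructor. -/
structure Create where
  type : SlotType
  name : Ident
  rhs : SlotExpr

/-- `ref_σ := se` in a transition. -/
structure Update where
  ref : Ref
  type : SlotType
  rhs : SlotExpr

structure CtorCase where
  cond : Expr
  creates : List Create

structure Constructor where
  iface : Iface
  payable : Bool
  pre : List Expr
  cases : List CtorCase
  post : List Expr

structure TransCase where
  cond : Expr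
  updates : List Update
  ret : Option Expr

structure Transition where
  name : Ident
  iface : Iface
  payable : Bool
  retType : Option ABIType
  pre : List Expr
  cases : List TransCase
  post : List Expr

/-- Storage typings `C` of a contract. -/
abbrev Storage := Ident → Option SlotType

/-- State typings `Σ`: storage typing, constructor and transitions of each declared contract. -/
@[ext]
structure StateTyping where
  storage : Ident → Option Storage
  cnstr : Ident → Option Constructor
  trans : Ident → Option (List Transition)

/-- `Σ' ⊆ Σ`. -/
def StateTyping.Sub (G' G : StateTyping) : Prop :=
  (∀ A C, G'.storage A = some C → G.storage A = some C) ∧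
  (∀ A c, G'.cnstr A = some c → G.cnstr A = some c) ∧
  (∀ A ts, G'.trans A = some ts → G.trans A = some ts)

/-- `Σ' ⊂ Σ`. -/
def StateTyping.SSub (G' G : StateTyping) : Prop := G'.Sub G ∧ G' ≠ G

/-- `Σ with {Storage = (Σ_Storage, A : C)}`. -/
def StateTyping.addStorage (G : StateTyping) (A : Ident) (C : Storage) : StateTyping :=
  { G with storage := Function.update G.storage A (some C) }

/-! ### Pointer semantics -/

/-- States annotated with a tag: a single state (untimed) or a pair of a pre-state and a
post-state (timed). -/
inductive TState
  | U (s : State)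
  | T (pre post : State)

/-- Timing of an evaluated reference. -/
inductive Timing
  | U | pre | post

/-- The dummy location `·`, used in place of the current location in constructors. -/
def noLoc : Addr := 0

/-- `ρ ; env ⇓_ℓ v` -/
inductive EvalEnv (ρ : Env) (l : Addr) : EnvVar → BaseValue → Prop
  | caller {b} : ρ .caller = some b → EvalEnv ρ l .caller b
  | origin {b} : ρ .origin = some b → EvalEnv ρ l .origin b
  | callvalue {b} : ρ .callvalue = some b → EvalEnv ρ l .callvalue b
  | this : EvalEnv ρ l .this (.addr l)

/-- Reading a storage field: `l ∈ dom s`, `x ∈ dom s(l)` and `s(l)(x) = v`. -/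
def Reads (s : State) (l : Addr) (x : Ident) (v : Value) : Prop :=
  ∃ o, s.lookup l = some o ∧ o.store x = some v

/-- Integer operators other than `div` and `mod`; `exp` has no integer value at a negative
exponent. -/
def IntOp.eval : IntOp → ℤ → ℤ → Option ℤ
  | .add, a, b => some (a + b)
  | .sub, a, b => some (a - b)
  | .mul, a, b => some (a * b)
  | .exp, a, b => if 0 ≤ b then some (a ^ b.toNat) else none
  | .div, _, _ => none
  | .mod, _, _ => none

def BoolOp.eval : BoolOp → Bool → Bool → Bool
  | .and, a, b => a && b
  | .or, a, b => a || b
  | .imp, a, b => !a || b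

def CmpOp.eval : CmpOp → ℤ → ℤ → Bool
  | .lt, a, b => decide (a < b)
  | .le, a, b => decide (a ≤ b)
  | .ge, a, b => decide (a ≥ b)
  | .gt, a, b => decide (a > b)

abbrev Value.int (n : ℤ) : Value := .base (.int n)

abbrev Value.bool (b : Bool) : Value := .base (.bool b)

mutual

/-- `s^t ; ρ ; ref ⇓_ℓ (v, t_p)` -/
inductive EvalRef : TState → Env → Addr → Ref → Value → Timing → Prop
  | env {st ρ l ev b} : EvalEnv ρ l ev b → EvalRef st ρ l (.env ev) (.base b) .U
  | storage {s ρ l x v} : Reads s l x v → ρ (.var x) = none →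
      EvalRef (.U s) ρ l (.var x) v .U
  | storagePre {s s' ρ l x v} : Reads s l x v → ρ (.var x) = none →
      EvalRef (.T s s') ρ l (.pre x) v .pre
  | storagePost {s s' ρ l x v} : Reads s' l x v → ρ (.var x) = none →
      EvalRef (.T s s') ρ l (.post x) v .post
  | calldata {s ρ l x b} : ρ (.var x) = some b →
      EvalRef (.U s) ρ l (.var x) (.base b) .U
  | calldataTimed {s s' ρ l x b} : ρ (.var x) = some b →
      EvalRef (.T s s') ρ l (.var x) (.base b) .pre
  | coerce {st ρ l r A v t} : EvalRef st ρ l r v t → EvalRef st ρ l (.coerce r A) v t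
  | field {s ρ l r x l' v} : EvalRef (.U s) ρ l r (.base (.addr l')) .U → Reads s l' x v →
      EvalRef (.U s) ρ l (.field r x) v .U
  | fieldPre {s s' ρ l r x l' v} :
      EvalRef (.T s s') ρ l r (.base (.addr l')) .pre → Reads s l' x v →
      EvalRef (.T s s') ρ l (.field r x) v .pre
  | fieldPost {s s' ρ l r x l' v} :
      EvalRef (.T s s') ρ l r (.base (.addr l')) .post → Reads s' l' x v →
      EvalRef (.T s s') ρ l (.field r x) v .post
  | index {st ρ l r e b f v t} : EvalExpr st ρ l e (.base b) → EvalRef st ρ l r f t →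
      f.app b = some v → EvalRef st ρ l (.index r e) v t

/-- `s ; ρ ; e ⇓_ℓ v` -/
inductive EvalExpr : TState → Env → Addr → Expr → Value → Prop
  | int {st ρ l n} : EvalExpr st ρ l (.int n) (.int n)
  | bool {st ρ l b} : EvalExpr st ρ l (.bool b) (.bool b)
  | ref {st ρ l r α v t} : EvalRef st ρ l r v t → EvalExpr st ρ l (.ref r α) v
  | addr {st ρ l r A v t} : EvalRef st ρ l r v t → EvalExpr st ρ l (.addr r A) v
  | rangeTrue {st ρ l ι e n} : EvalExpr st ρ l e (.int n) → ι.InRange n →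
      EvalExpr st ρ l (.inrange ι e) (.bool true)
  | rangeFalse {st ρ l ι e n} : EvalExpr st ρ l e (.int n) → ¬ ι.InRange n →
      EvalExpr st ρ l (.inrange ι e) (.bool false)
  | div {st ρ l e₁ e₂ m n} : EvalExpr st ρ l e₁ (.int m) → EvalExpr st ρ l e₂ (.int n) → n ≠ 0 →
      EvalExpr st ρ l (.iop .div e₁ e₂) (.int (m.tdiv n))
  | divZero {st ρ l e₁ e₂ m} : EvalExpr st ρ l e₁ (.int m) → EvalExpr st ρ l e₂ (.int 0) →
      EvalExpr st ρ l (.iop .div e₁ e₂) (.int 0)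
  | mod {st ρ l e₁ e₂ m n} : EvalExpr st ρ l e₁ (.int m) → EvalExpr st ρ l e₂ (.int n) → n ≠ 0 →
      EvalExpr st ρ l (.iop .mod e₁ e₂) (.int (m.tmod n))
  | modZero {st ρ l e₁ e₂ m} : EvalExpr st ρ l e₁ (.int m) → EvalExpr st ρ l e₂ (.int 0) →
      EvalExpr st ρ l (.iop .mod e₁ e₂) (.int 0)
  | iop {st ρ l op e₁ e₂ m n k} : EvalExpr st ρ l e₁ (.int m) → EvalExpr st ρ l e₂ (.int n) →
      op.eval m n = some k → EvalExpr st ρ l (.iop op e₁ e₂) (.int k)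
  | bop {st ρ l op e₁ e₂ a b} : EvalExpr st ρ l e₁ (.bool a) → EvalExpr st ρ l e₂ (.bool b) →
      EvalExpr st ρ l (.bop op e₁ e₂) (.bool (op.eval a b))
  | not {st ρ l e b} : EvalExpr st ρ l e (.bool b) → EvalExpr st ρ l (.not e) (.bool (!b))
  | cmp {st ρ l op e₁ e₂ m n} : EvalExpr st ρ l e₁ (.int m) → EvalExpr st ρ l e₂ (.int n) →
      EvalExpr st ρ l (.cmp op e₁ e₂) (.bool (op.eval m n))
  | iteTrue {st ρ l e₁ e₂ e₃ v} : EvalExpr st ρ l e₁ (.bool true) → EvalExpr st ρ l e₂ v →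
      EvalExpr st ρ l (.ite e₁ e₂ e₃) v
  | iteFalse {st ρ l e₁ e₂ e₃ v} : EvalExpr st ρ l e₁ (.bool false) → EvalExpr st ρ l e₃ v →
      EvalExpr st ρ l (.ite e₁ e₂ e₃) v
  | eqTrue {st ρ l e₁ e₂ v₁ v₂} : EvalExpr st ρ l e₁ v₁ → EvalExpr st ρ l e₂ v₂ → v₁ = v₂ →
      EvalExpr st ρ l (.eq e₁ e₂) (.bool true)
  | eqFalse {st ρ l e₁ e₂ v₁ v₂} : EvalExpr st ρ l e₁ v₁ → EvalExpr st ρ l e₂ v₂ → v₁ ≠ v₂ →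
      EvalExpr st ρ l (.eq e₁ e₂) (.bool false)

end

mutual

/-- `s ; ρ ; m ⇓_ℓ v`. If a key occurs twice in a mapping literal, its first occurrence counts. -/
inductive EvalMap : TState → Env → Addr → MapExpr → Value → Prop
  | exp {st ρ l e v} : EvalExpr st ρ l e v → EvalMap st ρ l (.exp e) v
  | map {st ρ l kvs β μ us} : EvalEntries st ρ l kvs us → (∀ p ∈ us, p.1.InMeta β) →
      EvalMap st ρ l (.map kvs β μ)
        (.ofFun β fun x => (us.lookup x).getD (defaultValue μ))
  | upd {st ρ l r kvs β μ us f t g} : EvalRef st ρ l r f t → f.IsMap β →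
      EvalEntries st ρ l kvs us → (∀ p ∈ us, p.1.InMeta β) →
      (∀ x u, f.app x = some u → g x = (us.lookup x).getD u) →
      EvalMap st ρ l (.upd r kvs β μ) (.ofFun β g)

/-- Evaluation of the entries `eᵢ ⇒ mᵢ` of a mapping literal to pairs `(vᵢ, uᵢ)`. -/
inductive EvalEntries :
    TState → Env → Addr → List (Expr × MapExpr) → List (BaseValue × Value) → Prop
  | nil {st ρ l} : EvalEntries st ρ l [] []
  | cons {st ρ l e m kvs b u us} : EvalExpr st ρ l e (.base b) → EvalMap st ρ l m u →
      EvalEntries st ρ l kvs us → EvalEntries st ρ l ((e, m) :: kvs) ((b, u) :: us)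

end

/-- The partial map `{x₁ ↦ v₁, …, xₙ ↦ vₙ}`. -/
def assign {V : Type} (xs : List Ident) (vs : List V) (x : Ident) : Option V :=
  (xs.zip vs).lookup x

/-- The environment `{xᵢ ↦ vᵢ}`, without values for the keywords. -/
def argEnv (I : Iface) (bs : List BaseValue) : Env
  | .var x => assign (I.map Prod.fst) bs x
  | _ => none

/-- The environment `{xᵢ ↦ vᵢ} ∪ {caller ↦ c, origin ↦ o, callvalue ↦ w}`. -/
def callEnv (I : Iface) (bs : List BaseValue) (c o w : BaseValue) : Env
  | .var x => assign (I.map Prod.fst) bs x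
  | .caller => some c
  | .origin => some o
  | .callvalue => some w

mutual

/-- `s ; ρ ; se ⇓_ℓ (v, s')`, where constructors are looked up in `G`. -/
inductive EvalSlot (G : StateTyping) :
    State → Env → Addr → SlotExpr → Value → State → Prop
  | map {s ρ l m v} : EvalMap (.U s) ρ l m v → EvalSlot G s ρ l (.map m) v s
  | ref {s ρ l r A v t} : EvalRef (.U s) ρ l r v t → EvalSlot G s ρ l (.ref r A) v s
  | addr {s ρ l se v s'} : EvalSlot G s ρ l se v s' → EvalSlot G s ρ l (.addr se) v s'
  | new {s ρ l A ses ctor bs sₙ o l' s'} : G.cnstr A = some ctor → ctor.payable = false →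
      ctor.iface.length = ses.length →
      EvalSlots G s ρ l ses (bs.map .base) sₙ →
      ρ .origin = some o →
      EvalCtorCases G sₙ (callEnv ctor.iface bs (.addr l) o (.int 0)) ctor.cases A l' s' →
      EvalSlot G s ρ l (.new A ses) (.base (.addr l')) s'
  | newPayable {s ρ l A val ses ctor bs w sₙ sₘ o l' s'} :
      G.cnstr A = some ctor → ctor.payable = true →
      ctor.iface.length = ses.length →
      EvalSlots G s ρ l ses (bs.map .base) sₙ →
      EvalSlot G sₙ ρ l val (.base w) sₘ →
      ρ .origin = some o →
      EvalCtorCases G sₘ (callEnv ctor.iface bs (.addr l) o w) ctor.cases A l' s' →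
      EvalSlot G s ρ l (.newPayable A val ses) (.base (.addr l')) s'

/-- Evaluation of `se₁, …, seₙ` from left to right, threading the state. -/
inductive EvalSlots (G : StateTyping) :
    State → Env → Addr → List SlotExpr → List Value → State → Prop
  | nil {s ρ l} : EvalSlots G s ρ l [] [] s
  | cons {s ρ l se ses v vs s' s''} : EvalSlot G s ρ l se v s' →
      EvalSlots G s' ρ l ses vs s'' → EvalSlots G s ρ l (se :: ses) (v :: vs) s''

/-- `s ; ρ ; creates ⇓_A (ℓ, s')` -/
inductive EvalCreates (G : StateTyping) :
    State → Env → List Create → Ident → Addr → State → Prop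
  | mk {s ρ cs A vs sₙ} : EvalSlots G s ρ noLoc (cs.map Create.rhs) vs sₙ →
      EvalCreates G s ρ cs A (fresh sₙ)
        (sₙ.insert (fresh sₙ) ⟨A, assign (cs.map Create.name) vs⟩)

/-- `s ; ρ ; ccases ⇓_A (ℓ, s')` -/
inductive EvalCtorCases (G : StateTyping) :
    State → Env → List CtorCase → Ident → Addr → State → Prop
  | mk {s ρ A l s'} {cases : List CtorCase} {j : ℕ} {c : CtorCase} : cases[j]? = some c →
      EvalExpr (.U s) ρ noLoc c.cond (.bool true) →
      (∀ (i : ℕ) (c' : CtorCase), i ≠ j → cases[i]? = some c' →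
        EvalExpr (.U s) ρ noLoc c'.cond (.bool false)) →
      EvalCreates G s ρ c.creates A l s' →
      EvalCtorCases G s ρ cases A l s'

end

/-- The state `s[ℓ ↦ s(ℓ)[x ↦ v]]`, where `o = s(ℓ)`. -/
def setField (s : State) (l : Addr) (o : Obj) (x : Ident) (v : Value) : State :=
  s.insert l ⟨o.type, Function.update o.store x (some v)⟩

/-- `Ins (s ; ρ ; ref ; v) ⇓_ℓ s'` -/
inductive Ins : State → Env → Addr → Ref → Value → State → Prop
  | storage {s ρ l o x v} : s.lookup l = some o → (∃ v₀, o.store x = some v₀) →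
      Ins s ρ l (.var x) v (setField s l o x v)
  | field {s ρ l r l' o x v} : EvalRef (.U s) ρ l r (.base (.addr l')) .U →
      s.lookup l' = some o → (∃ v₀, o.store x = some v₀) →
      Ins s ρ l (.field r x) v (setField s l' o x v)

/-- Insertion of `v₁, …, vₙ` at `ref₁, …, refₙ`, one after the other. -/
inductive InsAll : State → Env → Addr → List Ref → List Value → State → Prop
  | nil {s ρ l} : InsAll s ρ l [] [] s
  | cons {s ρ l r rs v vs s' s''} : Ins s ρ l r v s' → InsAll s' ρ l rs vs s'' →
      InsAll s ρ l (r :: rs) (v :: vs) s''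

/-- `s ; ρ ; updates ⇓_ℓ s'`: first all right-hand sides, then all insertions. -/
def EvalUpdates (G : StateTyping) (s : State) (ρ : Env) (l : Addr) (us : List Update)
    (s' : State) : Prop :=
  ∃ vs sₙ, EvalSlots G s ρ l (us.map Update.rhs) vs sₙ ∧ InsAll sₙ ρ l (us.map Update.ref) vs s'

/-- Evaluation of an optional return expression. -/
inductive EvalRet : TState → Env → Addr → Option Expr → Option Value → Prop
  | none {st ρ l} : EvalRet st ρ l none none
  | some {st ρ l e v} : EvalExpr st ρ l e v → EvalRet st ρ l (some e) (some v)

/-- `s ; ρ ; tcases ⇓_ℓ (v, s')` -/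
def EvalTransCases (G : StateTyping) (s : State) (ρ : Env) (l : Addr) (cases : List TransCase)
    (v : Option Value) (s' : State) : Prop :=
  ∃ (j : ℕ) (c : TransCase), cases[j]? = some c ∧
    EvalExpr (.U s) ρ l c.cond (.bool true) ∧
    (∀ (i : ℕ) (c' : TransCase), i ≠ j → cases[i]? = some c' →
      EvalExpr (.U s) ρ l c'.cond (.bool false)) ∧
    EvalUpdates G s ρ l c.updates s' ∧
    EvalRet (.T s s') ρ l c.ret v

/-- `s ; ρ ; cnstr ⇓_A (ℓ, s')` -/
def EvalCtor (G : StateTyping) (s : State) (ρ : Env) (c : Constructor) (A : Ident) (l : Addr)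
    (s' : State) : Prop :=
  (∀ e ∈ c.pre, EvalExpr (.U s) ρ noLoc e (.bool true)) ∧ EvalCtorCases G s ρ c.cases A l s'

/-- `s ; ρ ; trans ⇓_ℓ (v, s')` -/
def EvalTrans (G : StateTyping) (s : State) (ρ : Env) (l : Addr) (t : Transition)
    (v : Option Value) (s' : State) : Prop :=
  (∀ e ∈ t.pre, EvalExpr (.U s) ρ l e (.bool true)) ∧ EvalTransCases G s ρ l t.cases v s'

/-! ### Value and environment typing -/

/-- `⊢ v : β` -/
inductive BaseTyped : BaseValue → BaseType → Prop
  | addr {l} : BaseTyped (.addr l) .address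
  | bool {b} : BaseTyped (.bool b) .bool
  | int {n ι} : ι.InRange n → BaseTyped (.int n) (.int ι)

/-- `⊢ v : μ` -/
inductive MapTyped : Value → MapType → Prop
  | base {b β} : BaseTyped b β → MapTyped (.base b) (.base β)
  | mapping {f β μ} : f.IsMap β →
      (∀ b u, BaseTyped b β → f.app b = some u → MapTyped u μ) →
      MapTyped f (.mapping β μ)

/-- `Σ ⊢ v :_s σ`. The judgment `Σ ⊢ v :_s α` for ABI types is `ValueTyped G s v α.toSlot`. -/
inductive ValueTyped (G : StateTyping) (s : State) : Value → SlotType → Prop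
  | map {v μ} : MapTyped v μ → ValueTyped G s v (.map μ)
  | contractAddr {l o A C} : s.lookup l = some o → G.storage A = some C → o.type = A →
      (∀ x, (∃ v, o.store x = some v) ↔ ∃ σ, C x = some σ) →
      (∀ x σ v, C x = some σ → o.store x = some v → ValueTyped G s v σ) →
      ValueTyped G s (.base (.addr l)) (.contractAddr A)
  | contract {l A} : ValueTyped G s (.base (.addr l)) (.contractAddr A) →
      ValueTyped G s (.base (.addr l)) (.contract A)

/-- `Σ ⊢ ℓ :_s A?` for an optional contract type. -/
def LocTyped (G : StateTyping) (s : State) (l : Addr) : Option Ident → Prop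
  | none => True
  | some A => ValueTyped G s (.base (.addr l)) (.contract A)

/-- `Σ ⊢ ρ :_s I` -/
structure EnvTyped (G : StateTyping) (s : State) (ρ : Env) (I : Iface) : Prop where
  dom : ∀ x, (∃ b, ρ (.var x) = some b) ↔ ∃ α, I.lookup x = some α
  vars : ∀ x α b, I.lookup x = some α → ρ (.var x) = some b → ValueTyped G s (.base b) α.toSlot
  caller : ∃ b, ρ .caller = some b ∧ BaseTyped b .address
  origin : ∃ b, ρ .origin = some b ∧ BaseTyped b .address
  callvalue : ∃ b, ρ .callvalue = some b ∧ BaseTyped b .uint256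

/-! ### Transitions between states -/

/-- `Σ ⊢_A s ⇝_ℓ^C s'` -/
def StepCnstr (G : StateTyping) (A : Ident) (l : Addr) (s s' : State) : Prop :=
  ∃ ρ c, G.cnstr A = some c ∧ EnvTyped G s ρ c.iface ∧ EvalCtor G s ρ c A l s'

/-- `Σ ⊢_A s ⇝_ℓ^B s'` -/
def StepTrans (G : StateTyping) (A : Ident) (l : Addr) (s s' : State) : Prop :=
  ∃ ρ ts t v, ValueTyped G s (.base (.addr l)) (.contract A) ∧ G.trans A = some ts ∧ t ∈ ts ∧
    EnvTyped G s ρ t.iface ∧ EvalTrans G s ρ l t v s'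

/-- `Σ ⊢ s ⇝ s'` -/
def Step (G : StateTyping) (s s' : State) : Prop :=
  (∃ A l, StepCnstr G A l s s') ∨ ∃ A l, StepTrans G A l s s'

/-- `Σ ⊢ s ⇝* s'` -/
def Steps (G : StateTyping) : State → State → Prop := Relation.ReflTransGen (Step G)

/-! ### Semantic entailment -/

/-- `Σ ; I ; Φ ⊨_{A?} e₁, …, eₙ` -/
def ValidExps (G : StateTyping) (I : Iface) (Φ : Expr) (A : Option Ident) (es : List Expr) : Prop :=
  ∀ s ρ l, EnvTyped G s ρ I → LocTyped G s l A → EvalExpr (.U s) ρ l Φ (.bool true) →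
    ∀ e ∈ es, EvalExpr (.U s) ρ l e (.bool true)

/-- `Σ ; I ; Φ ⊨_{A?} (se₁, …, seₙ ; pre')`, where `I'` is the interface of the constructor whose
preconditions are `pre'`. -/
def ValidIffs (G : StateTyping) (I : Iface) (Φ : Expr) (A : Option Ident) (ses : List SlotExpr)
    (I' : Iface) (pre' : List Expr) : Prop :=
  ∀ s ρ l bs sₙ, EnvTyped G s ρ I → LocTyped G s l A → EvalExpr (.U s) ρ l Φ (.bool true) →
    EvalSlots G s ρ l ses (bs.map .base) sₙ →
    ∀ e ∈ pre', EvalExpr (.U sₙ) (argEnv I' bs) noLoc e (.bool true)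

/-! ### Typing -/

def Expr.and (e₁ e₂ : Expr) : Expr := .bop .and e₁ e₂

def Expr.conj (es : List Expr) : Expr := es.foldr Expr.and (.bool true)

def Expr.disj (es : List Expr) : Expr := es.foldr (Expr.bop .or) (.bool false)

/-- The conjunction of `¬ (eᵢ ∧ eⱼ)` over `i < j`. -/
def Expr.disjoint : List Expr → Expr
  | [] => .bool true
  | e :: es => .and (.conj (es.map fun e' => .not (.and e e'))) (disjoint es)

/-- If the preconditions hold, exactly one of the case conditions holds:
`⋀ pre ⇒ (⋁ᵢ eᵢ) ∧ ⋀_{i<j} ¬ (eᵢ ∧ eⱼ)`. -/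
def Expr.caseCond (pre conds : List Expr) : Expr :=
  .bop .imp (.conj pre) (.and (.disj conds) (.disjoint conds))

/-- `Σ ⊢ α wf` -/
inductive ABIType.WF (G : StateTyping) : ABIType → Prop
  | int {ι} : ι ≠ .unbounded → WF G (.base (.int ι))
  | contractAddr {α} : (∀ A, α = .contractAddr A → ∃ C, G.storage A = some C) → WF G α

/-- `Σ ⊢ σ wf` -/
inductive SlotType.WF (G : StateTyping) : SlotType → Prop
  | contract {A C} : G.storage A = some C → WF G (.contract A)
  | abi {α : ABIType} : α.WF G → WF G α.toSlot
  | map {μ} : WF G (.map μ)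

/-- `Σ ⊢ I wf` -/
def Iface.WF (G : StateTyping) (I : Iface) : Prop := ∀ p ∈ I, p.2.WF G

/-- `S`: reachable from the current contract's storage without coercion; `N`: all others. -/
inductive RefKind
  | S | N

/-- Untimed or timed judgment. -/
inductive Tag
  | U | T

/-- `Σ ; I ⊢_{A?} env : α` -/
inductive EnvVarTyped : Option Ident → EnvVar → ABIType → Prop
  | caller {A} : EnvVarTyped A .caller (.base .address)
  | origin {A} : EnvVarTyped A .origin (.base .address)
  | callvalue {A} : EnvVarTyped A .callvalue (.base .uint256)
  | this {A} : EnvVarTyped (some A) .this (.contractAddr A)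

mutual

/-- `Σ ; I ⊢^k_{A?, t} ref : σ` -/
inductive RefTyped (G : StateTyping) (I : Iface) :
    RefKind → Option Ident → Tag → Ref → SlotType → Prop
  | calldata {A t x α} : I.lookup x = some α → RefTyped G I .N A t (.var x) α.toSlot
  | storage {A C x σ} : G.storage A = some C → C x = some σ → I.lookup x = none →
      RefTyped G I .S (some A) .U (.var x) σ
  | storagePre {A C x σ} : G.storage A = some C → C x = some σ → I.lookup x = none →
      RefTyped G I .S (some A) .T (.pre x) σ
  | storagePost {A C x σ} : G.storage A = some C → C x = some σ → I.lookup x = none →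
      RefTyped G I .S (some A) .T (.post x) σ
  | coerce {k A t r B} : RefTyped G I k A t r (.contractAddr B) →
      RefTyped G I .N A t (.coerce r B) (.contract B)
  | upcast {k A t r B} : RefTyped G I k A t r (.contractAddr B) →
      RefTyped G I .N A t r (.map (.base .address))
  | field {k A t r B C x σ} : RefTyped G I k A t r (.contract B) →
      G.storage B = some C → C x = some σ → RefTyped G I k A t (.field r x) σ
  | index {k A t r e β μ} : RefTyped G I k A t r (.map (.mapping β μ)) →
      ExprTyped G I (.bool true) A t e β → RefTyped G I .N A t (.index r e) (.map μ)
  | env {A ev α} : EnvVarTyped A ev α → RefTyped G I .N A .U (.env ev) α.toSlot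

/-- `Σ ; I ; Φ ⊢_{A?, t} e : β` -/
inductive ExprTyped (G : StateTyping) (I : Iface) :
    Expr → Option Ident → Tag → Expr → BaseType → Prop
  | int {Φ A t n ι} : ι.InRange n → ExprTyped G I Φ A t (.int n) (.int ι)
  | bool {Φ A t b} : ExprTyped G I Φ A t (.bool b) .bool
  | ref {Φ A t k r β} : RefTyped G I k A t r (.map (.base β)) →
      ExprTyped G I Φ A t (.ref r (.base β)) β
  | addr {Φ A k r B} : RefTyped G I k A .U r (.contract B) →
      ExprTyped G I Φ A .U (.addr r B) .address
  | range {Φ A t ι₁ ι₂ e} : ExprTyped G I Φ A t e (.int ι₂) →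
      ExprTyped G I Φ A t (.inrange ι₁ e) .bool
  | iop {Φ A t op e₁ e₂ ι₁ ι₂ ι} : ExprTyped G I Φ A t e₁ (.int ι₁) →
      ExprTyped G I Φ A t e₂ (.int ι₂) → (t = .T → ι = .unbounded) →
      ValidExps G I Φ A [.inrange ι (.iop op e₁ e₂)] →
      ExprTyped G I Φ A t (.iop op e₁ e₂) (.int ι)
  | numConv {Φ A t e ι₁ ι₂} : ExprTyped G I Φ A t e (.int ι₁) →
      (ι₂ ≠ .unbounded → ValidExps G I Φ A [.inrange ι₂ e]) →
      ExprTyped G I Φ A t e (.int ι₂)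
  | bop {Φ A t op e₁ e₂} : ExprTyped G I Φ A t e₁ .bool → ExprTyped G I Φ A t e₂ .bool →
      ExprTyped G I Φ A t (.bop op e₁ e₂) .bool
  | not {Φ A t e} : ExprTyped G I Φ A t e .bool → ExprTyped G I Φ A t (.not e) .bool
  | cmp {Φ A t op e₁ e₂ ι} : ExprTyped G I Φ A t e₁ (.int ι) → ExprTyped G I Φ A t e₂ (.int ι) →
      ExprTyped G I Φ A t (.cmp op e₁ e₂) .bool
  | ite {Φ A t e₁ e₂ e₃ β} : ExprTyped G I Φ A t e₁ .bool → ExprTyped G I Φ A t e₂ β →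
      ExprTyped G I Φ A t e₃ β → ExprTyped G I Φ A t (.ite e₁ e₂ e₃) β
  | eq {Φ A t e₁ e₂ β} : ExprTyped G I Φ A t e₁ β → ExprTyped G I Φ A t e₂ β →
      ExprTyped G I Φ A t (.eq e₁ e₂) .bool

end

/-- `Σ ; I ; Φ ⊢_{A?} m : μ` -/
inductive MapExprTyped (G : StateTyping) (I : Iface) (Φ : Expr) (A : Option Ident) :
    MapExpr → MapType → Prop
  | exp {e β} : ExprTyped G I Φ A .U e β → MapExprTyped G I Φ A (.exp e) (.base β)
  | map {kvs β μ} : (∀ p ∈ kvs, ExprTyped G I Φ A .U p.1 β) →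
      (∀ p ∈ kvs, MapExprTyped G I Φ A p.2 μ) →
      MapExprTyped G I Φ A (.map kvs β μ) (.mapping β μ)
  | upd {k r kvs β μ} : RefTyped G I k A .U r (.map (.mapping β μ)) →
      (∀ p ∈ kvs, ExprTyped G I Φ A .U p.1 β) →
      (∀ p ∈ kvs, MapExprTyped G I Φ A p.2 μ) →
      MapExprTyped G I Φ A (.upd r kvs β μ) (.mapping β μ)

/-- `Σ ; I ; Φ ⊢_{A?} se : σ` -/
inductive SlotTyped (G : StateTyping) (I : Iface) (Φ : Expr) (A : Option Ident) :
    SlotExpr → SlotType → Prop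
  | map {m μ} : MapExprTyped G I Φ A m μ → SlotTyped G I Φ A (.map m) (.map μ)
  | ref {k r B} : RefTyped G I k A .U r (.contract B) → SlotTyped G I Φ A (.ref r B) (.contract B)
  | addr {se B} : SlotTyped G I Φ A se (.contract B) →
      SlotTyped G I Φ A (.addr se) (.contractAddr B)
  | new {B ctor ses} : G.cnstr B = some ctor → ctor.payable = false →
      ctor.iface.length = ses.length →
      (∀ p ∈ ses.zip ctor.iface, SlotTyped G I Φ A p.1 p.2.2.toSlot) →
      ValidIffs G I Φ A ses ctor.iface ctor.pre →
      SlotTyped G I Φ A (.new B ses) (.contract B)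
  | newPayable {B ctor val ses} : G.cnstr B = some ctor → ctor.payable = true →
      ctor.iface.length = ses.length →
      (∀ p ∈ ses.zip ctor.iface, SlotTyped G I Φ A p.1 p.2.2.toSlot) →
      SlotTyped G I Φ A val (.map (.base .uint256)) →
      ValidIffs G I Φ A ses ctor.iface ctor.pre →
      SlotTyped G I Φ A (.newPayable B val ses) (.contract B)

/-- `Σ ; I ; Φ ⊢_A creates : C` -/
def CreatesTyped (G : StateTyping) (I : Iface) (Φ : Expr) (cs : List Create) (C : Storage) : Prop :=
  (∀ c ∈ cs, c.type.WF G) ∧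
  C = assign (cs.map Create.name) (cs.map Create.type) ∧
  C balanceName = some (.map (.base .uint256)) ∧
  ∀ c ∈ cs, SlotTyped G I Φ none c.rhs c.type

/-- `ref ≺_specific ref'` -/
inductive MoreSpecific : Ref → Ref → Prop
  | field {r x} : MoreSpecific (.field r x) r
  | step {r₁ r₂ x} : MoreSpecific r₁ r₂ → MoreSpecific (.field r₁ x) r₂

/-- `Σ ; I ; Φ ⊢_A ref_σ := se` -/
def UpdateTyped (G : StateTyping) (I : Iface) (Φ : Expr) (A : Ident) (u : Update) : Prop :=
  RefTyped G I .S (some A) .U u.ref u.type ∧ SlotTyped G I Φ (some A) u.rhs u.type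

/-- `Σ ; I ; Φ ⊢_A updates`. An update must not be preceded by one of a more specific reference. -/
def UpdatesTyped (G : StateTyping) (I : Iface) (Φ : Expr) (A : Ident) (us : List Update) : Prop :=
  (∀ u ∈ us, UpdateTyped G I Φ A u) ∧
  ∀ (i j : ℕ) (uᵢ uⱼ : Update), j ≤ i → us[i]? = some uᵢ → us[j]? = some uⱼ →
    ¬ MoreSpecific uⱼ.ref uᵢ.ref

/-- `Σ ⊢_A cnstr : C`. There is at least one case. -/
structure CtorTyped (G : StateTyping) (A : Ident) (c : Constructor) (C : Storage) : Prop where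
  nonempty : c.cases ≠ []
  iface : c.iface.WF G
  pre : ∀ e ∈ c.pre, ExprTyped G c.iface (.bool true) none .U e .bool
  conds : ∀ k ∈ c.cases, ExprTyped G c.iface (.bool true) none .U k.cond .bool
  creates : ∀ k ∈ c.cases, CreatesTyped G c.iface (.and k.cond (.conj c.pre)) k.creates C
  disjoint : ∀ x, C x = none ∨ c.iface.lookup x = none
  post : ∀ e ∈ c.post, ExprTyped (G.addStorage A C) c.iface (.bool true) (some A) .U e .bool
  exactlyOne : ValidExps G c.iface (.bool true) none [.caseCond c.pre (c.cases.map CtorCase.cond)]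

/-- The optional return expression of a case has the optional return type of the transition. -/
inductive RetTyped (G : StateTyping) (I : Iface) (A : Ident) :
    Option Expr → Option ABIType → Prop
  | none : RetTyped G I A none none
  | some {e β} : ExprTyped G I (.bool true) (some A) .T e β → RetTyped G I A (some e) (some (.base β))

/-- `Σ ⊢_A trans` -/
structure TransTyped (G : StateTyping) (A : Ident) (t : Transition) : Prop where
  iface : t.iface.WF G
  pre : ∀ e ∈ t.pre, ExprTyped G t.iface (.bool true) (some A) .U e .bool
  conds : ∀ k ∈ t.cases, ExprTyped G t.iface (.bool true) (some A) .U k.cond .bool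
  updates : ∀ k ∈ t.cases, UpdatesTyped G t.iface (.and k.cond (.conj t.pre)) A k.updates
  ret : ∀ k ∈ t.cases, RetTyped G t.iface A k.ret t.retType
  post : ∀ e ∈ t.post, ExprTyped G t.iface (.bool true) (some A) .T e .bool
  exactlyOne :
    ValidExps G t.iface (.bool true) (some A) [.caseCond t.pre (t.cases.map TransCase.cond)]

/-- Well-typed state typings, defined inductively. The functions `w` and `w'` choose, for each
contract `A`, the smaller well-typed state typing in which the constructor, respectively the
transitions, of `A` are typed. The contracts with a storage typing are those with a constructor. -/
inductive WellTyped : StateTyping → Prop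
  | mk {G : StateTyping} (w w' : Ident → StateTyping)
      (dom : ∀ A, (∃ C, G.storage A = some C) ↔ ∃ c, G.cnstr A = some c)
      (cnstr_sub : ∀ A c, G.cnstr A = some c → (w A).SSub G)
      (cnstr_wt : ∀ A c, G.cnstr A = some c → WellTyped (w A))
      (cnstr_typed : ∀ A c C, G.cnstr A = some c → G.storage A = some C → CtorTyped (w A) A c C)
      (trans_sub : ∀ A ts, G.trans A = some ts → (w' A).SSub G)
      (trans_wt : ∀ A ts, G.trans A = some ts → WellTyped (w' A))
      (trans_typed : ∀ A ts, G.trans A = some ts → ∀ t ∈ ts, TransTyped (w' A) A t) :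
      WellTyped G

end Act

/-!
A slot expression can change the state only by allocating new contract instances. Hence
constructor steps, and the right-hand sides of updates, extend the state, and value typing is
monotone under extension.

An assignment, in contrast, overwrites a field. The new field value is well-typed in the old state,
but value typing is a least relation, so it must be excluded that the write closes a cycle of
references, which would leave its members untyped. The types of the fields of a contract are
well-formed in a strictly smaller state typing than the one declaring the contract, so induction
along well-typedness of `Σ` is induction on slot types in which the field types precede the
contract. This induction shows that replacing objects by objects that are well-typed in the *old*
state preserves value typing.

That assigned values have the declared type is type safety of slot expressions. Its side conditions
(ranges, constructor preconditions) are entailments about *some* evaluation, and they bear on the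
given one because evaluation of expressions is deterministic. They also refer to the smaller state
typing `Σ'` in which the code is typed, whereas the step evaluates in `Σ`; this makes no
difference, since the evaluation of code typed in `Σ'` looks up only constructors of `Σ'`.
-/

namespace Act

variable {G G' G₁ G₂ : StateTyping} {I : Iface} {Φ : Expr} {A : Ident} {A? : Option Ident}
  {C : Storage} {s s' : State} {ρ ρ' : Env} {l : Addr} {v : Value} {x : Ident} {μ : MapType}
  {σ : SlotType}

/-! ### Partial maps -/

theorem optionRel_iff {V W : Type*} {R : V → W → Prop} {a : Option V} {b : Option W} :
    Option.Rel R a b ↔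
      ((∃ v, a = some v) ↔ ∃ w, b = some w) ∧ ∀ w v, b = some w → a = some v → R v w := by
  cases a <;> cases b <;> simp

theorem mem_of_lookup_eq_some {K V : Type*} [BEq K] [LawfulBEq K] {kvs : List (K × V)} {k : K}
    {v : V} (h : kvs.lookup k = some v) : (k, v) ∈ kvs := by
  obtain ⟨kvs₁, kvs₂, rfl, -⟩ := List.lookup_eq_some_iff.1 h
  simp

theorem lookup_eq_assign {V : Type} (kvs : List (Ident × V)) (x : Ident) :
    kvs.lookup x = assign (kvs.map Prod.fst) (kvs.map Prod.snd) x := by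
  rw [assign, ← List.unzip_fst, ← List.unzip_snd, List.zip_unzip]

theorem optionRel_assign {V W : Type} {R : V → W → Prop} {vs : List V} {ws : List W}
    (h : List.Forall₂ R vs ws) (xs : List Ident) (x : Ident) :
    Option.Rel R (assign xs vs x) (assign xs ws x) := by
  unfold assign
  induction h generalizing xs with
  | nil => simp
  | cons hR _ ih =>
    cases xs with
    | nil => simp
    | cons y ys =>
      simp only [List.zip_cons_cons, List.lookup_cons]
      split
      · exact .some hR
      · exact ih ys

theorem forall₂_map_map {U V W : Type*} {R : V → W → Prop} {f : U → V} {g : U → W} {us : List U}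
    (h : ∀ u ∈ us, R (f u) (g u)) : List.Forall₂ R (us.map f) (us.map g) := by
  rwa [List.forall₂_map_left_iff, List.forall₂_map_right_iff, List.forall₂_same]

/-! ### Well-typed state typings -/

theorem StateTyping.Sub.refl (G : StateTyping) : G.Sub G :=
  ⟨fun _ _ h => h, fun _ _ h => h, fun _ _ h => h⟩

theorem StateTyping.Sub.trans (h : G.Sub G₁) (h' : G₁.Sub G₂) : G.Sub G₂ :=
  ⟨fun _ _ e => h'.1 _ _ (h.1 _ _ e), fun _ _ e => h'.2.1 _ _ (h.2.1 _ _ e),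
    fun _ _ e => h'.2.2 _ _ (h.2.2 _ _ e)⟩

theorem ABIType.WF.mono (hs : G'.Sub G) {α : ABIType} (h : α.WF G') : α.WF G := by
  cases h with
  | int hι => exact .int hι
  | contractAddr h => exact .contractAddr fun A hA => (h A hA).imp (hs.1 A)

theorem SlotType.WF.mono (hs : G'.Sub G) (h : σ.WF G') : σ.WF G := by
  cases h with
  | contract hC => exact .contract (hs.1 _ _ hC)
  | abi hα => exact .abi (hα.mono hs)
  | map => exact .map

theorem SlotType.wf_contractAddr_iff :
    SlotType.WF G (.contractAddr A) ↔ ∃ C, G.storage A = some C := by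
  constructor
  · generalize hσ : SlotType.contractAddr A = σ
    rintro (_ | @⟨α, hα⟩ | _)
    · cases hσ
    · cases α <;> cases hσ
      cases hα with
      | contractAddr h => exact h A rfl
    · cases hσ
  · rintro hA
    refine .abi (α := .contractAddr A) (.contractAddr ?_)
    rintro _ ⟨⟩
    exact hA

theorem SlotType.wf_contract_iff : SlotType.WF G (.contract A) ↔ ∃ C, G.storage A = some C := by
  constructor
  · generalize hσ : SlotType.contract A = σ
    rintro (hC | @⟨α, -⟩ | _)
    · cases hσ
      exact ⟨_, hC⟩
    · cases α <;> cases hσ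
    · cases hσ
  · rintro ⟨_, hC⟩
    exact .contract hC

theorem CtorTyped.field_wf {c : Constructor} (h : CtorTyped G A c C) (hx : C x = some σ) :
    σ.WF G := by
  obtain ⟨k, hk⟩ := List.exists_mem_of_ne_nil _ h.nonempty
  obtain ⟨hwf, rfl, -, -⟩ := h.creates k hk
  obtain ⟨d, hd, rfl⟩ := List.mem_map.1 (List.of_mem_zip (mem_of_lookup_eq_some hx)).2
  exact hwf d hd

theorem WellTyped.exists_ctorTyped (hG : WellTyped G) {c : Constructor}
    (hc : G.cnstr A = some c) :
    ∃ G' C, WellTyped G' ∧ G'.Sub G ∧ G.storage A = some C ∧ CtorTyped G' A c C := by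
  obtain ⟨w, _, dom, ctor_sub, ctor_wt, ctor_typed, -, -, -⟩ := hG
  obtain ⟨C, hC⟩ := (dom A).2 ⟨c, hc⟩
  exact ⟨w A, C, ctor_wt A c hc, (ctor_sub A c hc).1, hC, ctor_typed A c C hc hC⟩

theorem WellTyped.exists_transTyped (hG : WellTyped G) {ts : List Transition}
    (hts : G.trans A = some ts) :
    ∃ G', WellTyped G' ∧ G'.Sub G ∧ ∀ t ∈ ts, TransTyped G' A t := by
  obtain ⟨_, w', -, -, -, -, trans_sub, trans_wt, trans_typed⟩ := hG
  exact ⟨w' A, trans_wt A ts hts, (trans_sub A ts hts).1, trans_typed A ts hts⟩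

theorem WellTyped.field_wf (hG : WellTyped G) (hC : G.storage A = some C) (hx : C x = some σ) :
    σ.WF G := by
  obtain ⟨w, _, dom, ctor_sub, -, ctor_typed, -, -, -⟩ := hG
  obtain ⟨c, hc⟩ := (dom A).1 ⟨C, hC⟩
  exact ((ctor_typed A c C hc hC).field_wf hx).mono (ctor_sub A c hc).1

theorem WellTyped.slotType_induction (hG : WellTyped G) {motive : SlotType → Prop}
    (map : ∀ μ, motive (.map μ))
    (contractAddr : ∀ A, (∀ C x σ, G.storage A = some C → C x = some σ → motive σ) →
      motive (.contractAddr A))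
    (contract : ∀ A, motive (.contractAddr A) → motive (.contract A)) (σ : SlotType) :
    motive σ := by
  have of_wf {H : StateTyping} (hH : WellTyped H) :
      H.Sub G → ∀ σ : SlotType, σ.WF H → motive σ := by
    induction hH with
    | @mk H w _ dom ctor_sub _ ctor_typed _ _ _ ih _ =>
      intro hs
      have of_declared (A : Ident) : (∃ D, H.storage A = some D) → motive (.contractAddr A) := by
        rintro ⟨D, hD⟩
        obtain ⟨c, hc⟩ := (dom A).1 ⟨D, hD⟩
        refine contractAddr A fun C x τ hC hx => ?_
        obtain rfl : D = C := Option.some.inj ((hs.1 A D hD).symm.trans hC)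
        exact ih A c hc ((ctor_sub A c hc).1.trans hs) τ ((ctor_typed A c D hc hD).field_wf hx)
      rintro (μ | A | A) hσ
      · exact map μ
      · exact of_declared A (SlotType.wf_contractAddr_iff.1 hσ)
      · exact contract A (of_declared A (SlotType.wf_contract_iff.1 hσ))
  have addr (A : Ident) : motive (.contractAddr A) := contractAddr A fun C x σ hC hx =>
    of_wf hG (.refl G) σ (hG.field_wf hC hx)
  exact σ.rec map addr fun A => contract A (addr A)

/-! ### Value typing -/

/-- `o` is an instance of `A` whose fields are those of `C`, with values of their types: the
premises on the object `s(ℓ)` in the typing rule of `address_A`. -/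
structure ObjTyped (G : StateTyping) (s : State) (o : Obj) (A : Ident) (C : Storage) : Prop where
  type_eq : o.type = A
  fields : ∀ x, Option.Rel (ValueTyped G s) (o.store x) (C x)

theorem ObjTyped.imp {o : Obj} (h : ObjTyped G s o A C)
    (hv : ∀ x σ v, C x = some σ → ValueTyped G s v σ → ValueTyped G' s' v σ) :
    ObjTyped G' s' o A C where
  type_eq := h.type_eq
  fields x :=
    have ⟨hdom, hfield⟩ := optionRel_iff.1 (h.fields x)
    optionRel_iff.2 ⟨hdom, fun σ v hσ hv' => hv x σ v hσ (hfield σ v hσ hv')⟩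

theorem ObjTyped.update {o : Obj} (h : ObjTyped G s o A C) (hx : C x = some σ)
    (hv : ValueTyped G s v σ) :
    ObjTyped G s ⟨o.type, Function.update o.store x (some v)⟩ A C where
  type_eq := h.type_eq
  fields y := by
    by_cases hy : y = x
    · subst hy
      simpa [hx] using hv
    · simpa [Function.update_of_ne hy] using h.fields y

theorem valueTyped_map_iff : ValueTyped G s v (.map μ) ↔ MapTyped v μ :=
  ⟨fun h => by cases h; assumption, .map⟩

theorem valueTyped_contractAddr_iff :
    ValueTyped G s v (.contractAddr A) ↔ ∃ l o C, v = .base (.addr l) ∧ s.lookup l = some o ∧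
      G.storage A = some C ∧ ObjTyped G s o A C := by
  constructor
  · rintro (_ | ⟨ho, hC, ht, hdom, hfield⟩)
    exact ⟨_, _, _, rfl, ho, hC, ht, fun x => optionRel_iff.2 ⟨hdom x, hfield x⟩⟩
  · rintro ⟨l, o, C, rfl, ho, hC, h⟩
    exact .contractAddr ho hC h.type_eq (fun x => (optionRel_iff.1 (h.fields x)).1)
      fun x => (optionRel_iff.1 (h.fields x)).2

theorem valueTyped_contract_iff :
    ValueTyped G s v (.contract A) ↔ ValueTyped G s v (.contractAddr A) := by
  constructor
  · rintro (_ | _ | h)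
    exact h
  · intro h
    obtain ⟨l, o, C, rfl, -⟩ := valueTyped_contractAddr_iff.1 h
    exact .contract h

theorem ValueTyped.objTyped {o : Obj} (h : ValueTyped G s (.base (.addr l)) (.contract A))
    (hC : G.storage A = some C) (ho : s.lookup l = some o) : ObjTyped G s o A C := by
  obtain ⟨_, o', C', ⟨⟩, ho', hC', hobj⟩ :=
    valueTyped_contractAddr_iff.1 (valueTyped_contract_iff.1 h)
  cases ho.symm.trans ho'
  cases hC.symm.trans hC'
  exact hobj

theorem ValueTyped.of_reads (h : ValueTyped G s (.base (.addr l)) (.contract A))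
    (hC : G.storage A = some C) (hx : C x = some σ) (hr : Reads s l x v) :
    ValueTyped G s v σ := by
  obtain ⟨o, ho, hv⟩ := hr
  exact (optionRel_iff.1 ((h.objTyped hC ho).fields x)).2 σ v hx hv

theorem ValueTyped.mono (hs : G'.Sub G) (hv : ValueTyped G' s v σ) : ValueTyped G s v σ := by
  induction hv with
  | map h => exact .map h
  | contractAddr ho hC ht hdom _ ih => exact .contractAddr ho (hs.1 _ _ hC) ht hdom ih
  | contract _ ih => exact .contract ih

theorem ValueTyped.restrict (hG' : WellTyped G') (hs : G'.Sub G) (hv : ValueTyped G s v σ)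
    (hσ : σ.WF G') : ValueTyped G' s v σ := by
  induction hv with
  | map h => exact .map h
  | @contractAddr l o A C ho hC ht hdom _ ih =>
    obtain ⟨C', hC'⟩ := SlotType.wf_contractAddr_iff.1 hσ
    obtain rfl : C' = C := Option.some.inj ((hs.1 _ _ hC').symm.trans hC)
    exact .contractAddr ho hC' ht hdom fun x σ v hx hv => ih x σ v hx hv (hG'.field_wf hC' hx)
  | contract _ ih =>
    exact .contract (ih (SlotType.wf_contractAddr_iff.2 (SlotType.wf_contract_iff.1 hσ)))

theorem ValueTyped.of_objTyped (hG : WellTyped G)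
    (hs : ∀ l o A C, s.lookup l = some o → G.storage A = some C → ObjTyped G s o A C →
      ∃ o', s'.lookup l = some o' ∧ ObjTyped G s o' A C)
    (hv : ValueTyped G s v σ) : ValueTyped G s' v σ := by
  induction σ using hG.slotType_induction generalizing v with
  | map μ => exact .map (valueTyped_map_iff.1 hv)
  | contractAddr A ih =>
    obtain ⟨l, o, C, rfl, ho, hC, hobj⟩ := valueTyped_contractAddr_iff.1 hv
    obtain ⟨o', ho', hobj'⟩ := hs l o A C ho hC hobj
    exact valueTyped_contractAddr_iff.2
      ⟨l, o', C, rfl, ho', hC, hobj'.imp fun x σ _ hx hv => ih C x σ hC hx hv⟩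
  | contract A ih => exact valueTyped_contract_iff.2 (ih (valueTyped_contract_iff.1 hv))

theorem EnvTyped.imp (h : EnvTyped G s ρ I)
    (hv : ∀ x α v, I.lookup x = some α → ValueTyped G s v α.toSlot →
      ValueTyped G' s' v α.toSlot) :
    EnvTyped G' s' ρ I where
  dom := h.dom
  vars x α b hx hb := hv x α _ hx (h.vars x α b hx hb)
  caller := h.caller
  origin := h.origin
  callvalue := h.callvalue

theorem EnvTyped.restrict (hG' : WellTyped G') (hs : G'.Sub G) (hI : I.WF G')
    (h : EnvTyped G s ρ I) : EnvTyped G' s ρ I :=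
  h.imp fun _ _ _ hx hv => hv.restrict hG' hs (.abi (hI _ (mem_of_lookup_eq_some hx)))

theorem EnvTyped.of_origin {b : BaseValue} (h : EnvTyped G s ρ I) (hb : ρ .origin = some b) :
    BaseTyped b .address := by
  simpa [hb] using h.origin

/-! ### Extension of states and environments -/

/-- `s'` arises from `s` by adding contract instances. -/
def State.Extends (s s' : State) : Prop := ∀ l o, s.lookup l = some o → s'.lookup l = some o

theorem State.Extends.refl (s : State) : State.Extends s s := fun _ _ h => h

theorem State.Extends.trans {s₁ s₂ s₃ : State} (h : State.Extends s₁ s₂)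
    (h' : State.Extends s₂ s₃) : State.Extends s₁ s₃ := fun l o ho => h' l o (h l o ho)

theorem State.Extends.keys_subset (h : State.Extends s s') : s.keys ⊆ s'.keys := by
  intro l hl
  rw [Finmap.mem_keys, Finmap.mem_iff] at hl ⊢
  exact hl.imp (h l)

theorem lookup_fresh (s : State) : s.lookup (fresh s) = none := by
  rw [Finmap.lookup_eq_none, ← Finmap.mem_keys]
  intro h
  exact Nat.not_succ_le_self _ (Finset.le_sup (f := id) h)

theorem State.extends_insert_fresh (s : State) (o : Obj) :
    State.Extends s (s.insert (fresh s) o) := by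
  intro l o' h
  rw [Finmap.lookup_insert_of_ne, h]
  rintro rfl
  simp [lookup_fresh] at h

theorem ValueTyped.extend (hs : State.Extends s s') (hv : ValueTyped G s v σ) :
    ValueTyped G s' v σ := by
  induction hv with
  | map h => exact .map h
  | contractAddr ho hC ht hdom _ ih => exact .contractAddr (hs _ _ ho) hC ht hdom ih
  | contract _ ih => exact .contract ih

theorem EnvTyped.extend (hs : State.Extends s s') (h : EnvTyped G s ρ I) : EnvTyped G s' ρ I :=
  h.imp fun _ _ _ _ hv => hv.extend hs

theorem LocTyped.extend (hs : State.Extends s s') (h : LocTyped G s l A?) :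
    LocTyped G s' l A? := by
  cases A? with
  | none => trivial
  | some A => exact ValueTyped.extend hs h

theorem Reads.extend (hs : State.Extends s s') (h : Reads s l x v) : Reads s' l x v := by
  obtain ⟨o, ho, hv⟩ := h
  exact ⟨o, hs l o ho, hv⟩

/-- Componentwise extension of tagged states. -/
inductive TState.Extends : TState → TState → Prop
  | U {s s' : State} : State.Extends s s' → TState.Extends (.U s) (.U s')
  | T {s₁ s₁' s₂ s₂' : State} : State.Extends s₁ s₁' → State.Extends s₂ s₂' →
      TState.Extends (.T s₁ s₂) (.T s₁' s₂')

/-- `ρ'` arises from `ρ` by adding values for keywords. No variables may be added, since they would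
shadow storage fields. -/
structure Env.Extends (ρ ρ' : Env) : Prop where
  var_eq : ∀ x, ρ' (.var x) = ρ (.var x)
  some_of_some : ∀ k b, ρ k = some b → ρ' k = some b

theorem Env.Extends.refl (ρ : Env) : Env.Extends ρ ρ := ⟨fun _ => rfl, fun _ _ h => h⟩

theorem Env.extends_argEnv_callEnv (I : Iface) (bs : List BaseValue) (c o w : BaseValue) :
    Env.Extends (argEnv I bs) (callEnv I bs c o w) where
  var_eq _ := rfl
  some_of_some
    | .var _, _, h => h

mutual

theorem EvalRef.extend {st st' : TState} {l : Addr} {r : Ref} {v : Value} {t : Timing}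
    (hs : st.Extends st') (hρ : Env.Extends ρ ρ') :
    EvalRef st ρ l r v t → EvalRef st' ρ' l r v t
  | .env (.caller h) => .env (.caller (hρ.some_of_some _ _ h))
  | .env (.origin h) => .env (.origin (hρ.some_of_some _ _ h))
  | .env (.callvalue h) => .env (.callvalue (hρ.some_of_some _ _ h))
  | .env .this => .env .this
  | .storage h hx => let .U hs := hs; .storage (h.extend hs) (by rw [hρ.var_eq, hx])
  | .storagePre h hx => let .T hs _ := hs; .storagePre (h.extend hs) (by rw [hρ.var_eq, hx])
  | .storagePost h hx => let .T _ hs := hs; .storagePost (h.extend hs) (by rw [hρ.var_eq, hx])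
  | .calldata h => let .U _ := hs; .calldata (hρ.some_of_some _ _ h)
  | .calldataTimed h => let .T _ _ := hs; .calldataTimed (hρ.some_of_some _ _ h)
  | .coerce h => .coerce (h.extend hs hρ)
  | .field h hr => let .U hs := hs; .field (h.extend (.U hs) hρ) (hr.extend hs)
  | .fieldPre h hr => let .T hs₁ hs₂ := hs; .fieldPre (h.extend (.T hs₁ hs₂) hρ) (hr.extend hs₁)
  | .fieldPost h hr =>
    let .T hs₁ hs₂ := hs; .fieldPost (h.extend (.T hs₁ hs₂) hρ) (hr.extend hs₂)
  | .index he hr ha => .index (he.extend hs hρ) (hr.extend hs hρ) ha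

theorem EvalExpr.extend {st st' : TState} {l : Addr} {e : Expr} {v : Value}
    (hs : st.Extends st') (hρ : Env.Extends ρ ρ') : EvalExpr st ρ l e v → EvalExpr st' ρ' l e v
  | .int => .int
  | .bool => .bool
  | .ref h => .ref (h.extend hs hρ)
  | .addr h => .addr (h.extend hs hρ)
  | .rangeTrue h hr => .rangeTrue (h.extend hs hρ) hr
  | .rangeFalse h hr => .rangeFalse (h.extend hs hρ) hr
  | .div h₁ h₂ hn => .div (h₁.extend hs hρ) (h₂.extend hs hρ) hn
  | .divZero h₁ h₂ => .divZero (h₁.extend hs hρ) (h₂.extend hs hρ)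
  | .mod h₁ h₂ hn => .mod (h₁.extend hs hρ) (h₂.extend hs hρ) hn
  | .modZero h₁ h₂ => .modZero (h₁.extend hs hρ) (h₂.extend hs hρ)
  | .iop h₁ h₂ hk => .iop (h₁.extend hs hρ) (h₂.extend hs hρ) hk
  | .bop h₁ h₂ => .bop (h₁.extend hs hρ) (h₂.extend hs hρ)
  | .not h => .not (h.extend hs hρ)
  | .cmp h₁ h₂ => .cmp (h₁.extend hs hρ) (h₂.extend hs hρ)
  | .iteTrue h₁ h₂ => .iteTrue (h₁.extend hs hρ) (h₂.extend hs hρ)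
  | .iteFalse h₁ h₂ => .iteFalse (h₁.extend hs hρ) (h₂.extend hs hρ)
  | .eqTrue h₁ h₂ e => .eqTrue (h₁.extend hs hρ) (h₂.extend hs hρ) e
  | .eqFalse h₁ h₂ e => .eqFalse (h₁.extend hs hρ) (h₂.extend hs hρ) e

end


theorem EvalExpr.and_true {st : TState} {e₁ e₂ : Expr} (h₁ : EvalExpr st ρ l e₁ (.bool true))
    (h₂ : EvalExpr st ρ l e₂ (.bool true)) : EvalExpr st ρ l (.and e₁ e₂) (.bool true) :=
  .bop (op := .and) h₁ h₂

theorem EvalExpr.conj_true {st : TState} {es : List Expr}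
    (h : ∀ e ∈ es, EvalExpr st ρ l e (.bool true)) : EvalExpr st ρ l (.conj es) (.bool true) := by
  induction es with
  | nil => exact .bool
  | cons e es ih =>
    rw [List.forall_mem_cons] at h
    exact .and_true h.1 (ih h.2)

/-! ### Determinism -/

theorem EvalEnv.det {ev : EnvVar} {b b' : BaseValue} (h : EvalEnv ρ l ev b)
    (h' : EvalEnv ρ l ev b') : b = b' := by
  cases h <;> cases h' <;> simp_all

theorem Reads.det {v' : Value} (h : Reads s l x v) (h' : Reads s l x v') : v = v' := by
  obtain ⟨o, ho, hv⟩ := h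
  obtain ⟨o', ho', hv'⟩ := h'
  simp_all

mutual

theorem EvalRef.det {st : TState} {ρ : Env} {l : Addr} {r : Ref} {v v' : Value} {t t' : Timing} :
    EvalRef st ρ l r v t → EvalRef st ρ l r v' t' → v = v' ∧ t = t'
  | .env h, h' => by cases h' with | env h' => exact ⟨by rw [h.det h'], rfl⟩
  | .storage h _, h' => by
    cases h' with
    | storage h' => exact ⟨h.det h', rfl⟩
    | calldata h' => simp_all
  | .storagePre h _, h' => by cases h' with | storagePre h' => exact ⟨h.det h', rfl⟩
  | .storagePost h _, h' => by cases h' with | storagePost h' => exact ⟨h.det h', rfl⟩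
  | .calldata h, h' => by cases h' <;> simp_all
  | .calldataTimed h, h' => by cases h' with | calldataTimed h' => simp_all
  | .coerce h, h' => by cases h' with | coerce h' => exact h.det h'
  | .field h hr, h' => by
    cases h' with
    | field h' hr' =>
      obtain ⟨⟨⟩, -⟩ := h.det h'
      exact ⟨hr.det hr', rfl⟩
  | .fieldPre h hr, h' | .fieldPost h hr, h' => by
    cases h' <;> rename_i h' hr' <;> obtain ⟨⟨⟩, ⟨⟩⟩ := h.det h'
    exact ⟨hr.det hr', rfl⟩
  | .index he hr ha, h' => by
    cases h' with
    | index he' hr' ha' =>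
      cases he.det he'
      obtain ⟨rfl, rfl⟩ := hr.det hr'
      exact ⟨Option.some.inj (ha.symm.trans ha'), rfl⟩

theorem EvalExpr.det {st : TState} {ρ : Env} {l : Addr} {e : Expr} {v v' : Value} :
    EvalExpr st ρ l e v → EvalExpr st ρ l e v' → v = v'
  | .int, h' | .bool, h' => by cases h'; rfl
  | .ref h, h' => by cases h' with | ref h' => exact (h.det h').1
  | .addr h, h' => by cases h' with | addr h' => exact (h.det h').1
  | .rangeTrue h _, h' | .rangeFalse h _, h' | .not h, h' => by
    have hdet {w : Value} := h.det (v' := w)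
    cases h' <;> grind
  | .div h₁ h₂ _, h' | .divZero h₁ h₂, h' | .mod h₁ h₂ _, h' | .modZero h₁ h₂, h'
  | .iop h₁ h₂ _, h' | .bop h₁ h₂, h' | .cmp h₁ h₂, h' | .iteTrue h₁ h₂, h'
  | .iteFalse h₁ h₂, h' | .eqTrue h₁ h₂ _, h' | .eqFalse h₁ h₂ _, h' => by
    have hdet₁ {w : Value} := h₁.det (v' := w)
    have hdet₂ {w : Value} := h₂.det (v' := w)
    cases h' <;> grind [IntOp.eval]

end

/-! ### Type safety of expressions -/

/-- The configurations over which the entailments `Σ ; I ; Φ ⊨_{A?} _` quantify: those that are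
well-typed under `Σ` and satisfy the assumptions `Φ`. -/
structure ConfigTyped (G : StateTyping) (I : Iface) (Φ : Expr) (A? : Option Ident) (s : State)
    (ρ : Env) (l : Addr) : Prop where
  env : EnvTyped G s ρ I
  loc : LocTyped G s l A?
  assumption : EvalExpr (.U s) ρ l Φ (.bool true)

theorem ConfigTyped.extend (hs : State.Extends s s') (h : ConfigTyped G I Φ A? s ρ l) :
    ConfigTyped G I Φ A? s' ρ l :=
  ⟨h.env.extend hs, h.loc.extend hs, h.assumption.extend (.U hs) (.refl ρ)⟩

theorem ConfigTyped.no_assumption (h : ConfigTyped G I Φ A? s ρ l) :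
    ConfigTyped G I (.bool true) A? s ρ l :=
  ⟨h.env, h.loc, .bool⟩

theorem EnvVarTyped.valueTyped_of_eval {ev : EnvVar} {α : ABIType} {b : BaseValue}
    (hev : EnvVarTyped A? ev α) (hρ : EnvTyped G s ρ I) (hl : LocTyped G s l A?)
    (h : EvalEnv ρ l ev b) : ValueTyped G s (.base b) α.toSlot := by
  cases hev with
  | caller => cases h with | caller h => exact .map (.base (by simpa [h] using hρ.caller))
  | origin => cases h with | origin h => exact .map (.base (hρ.of_origin h))
  | callvalue => cases h with | callvalue h => exact .map (.base (by simpa [h] using hρ.callvalue))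
  | this => cases h with | this => exact valueTyped_contract_iff.1 hl

theorem ValidExps.mapTyped_of_eval {ι : IntType} {e : Expr}
    (hvalid : ValidExps G I Φ A? [.inrange ι e]) (hs : ConfigTyped G I Φ A? s ρ l)
    (h : EvalExpr (.U s) ρ l e v) : MapTyped v (.base (.int ι)) := by
  cases hvalid s ρ l hs.env hs.loc hs.assumption _ (List.mem_singleton.2 rfl) with
  | rangeTrue h' hn =>
    cases h'.det h
    exact .base (.int hn)

-- `tag` is a variable because structural recursion needs it to be free in the typing derivations.
mutual

theorem RefTyped.valueTyped_of_eval {G : StateTyping} {I : Iface} {k : RefKind}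
    {A? : Option Ident} {tag : Tag} {r : Ref} {σ : SlotType} {s : State} {ρ : Env} {l : Addr}
    {v : Value} {t : Timing} (htag : tag = .U) (hs : ConfigTyped G I (.bool true) A? s ρ l) :
    RefTyped G I k A? tag r σ → EvalRef (.U s) ρ l r v t → ValueTyped G s v σ
  | .calldata (x := x) hx, h => by
    have hdom := (hs.env.dom x).2 ⟨_, hx⟩
    cases h with
    | storage _ hn => simp [hn] at hdom
    | calldata h => exact hs.env.vars _ _ _ hx h
  | .storage (x := x) hC hσ hx, h => by
    have hdom := (hs.env.dom x).1
    cases h with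
    | storage hr => exact ValueTyped.of_reads hs.loc hC hσ hr
    | calldata h => simp [h, hx] at hdom
  | .storagePre .., _ | .storagePost .., _ => by cases htag
  | .coerce hr, h => by
    cases h with | coerce h => exact valueTyped_contract_iff.2 (hr.valueTyped_of_eval htag hs h)
  | .upcast hr, h => by
    obtain ⟨_, _, _, rfl, -⟩ := valueTyped_contractAddr_iff.1 (hr.valueTyped_of_eval htag hs h)
    exact .map (.base .addr)
  | .field hr hC hσ, h => by
    cases h with | field h hx => exact (hr.valueTyped_of_eval htag hs h).of_reads hC hσ hx
  | .index hr he, h => by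
    cases h with
    | index h' h happ =>
      cases he.mapTyped_of_eval htag hs h' with
      | base hb =>
        cases valueTyped_map_iff.1 (hr.valueTyped_of_eval htag hs h) with
        | mapping _ hf => exact .map (hf _ _ hb happ)
  | .env hev, h => by cases h with | env h => exact hev.valueTyped_of_eval hs.env hs.loc h

theorem ExprTyped.mapTyped_of_eval {G : StateTyping} {I : Iface} {Φ : Expr} {A? : Option Ident}
    {tag : Tag} {e : Expr} {β : BaseType} {s : State} {ρ : Env} {l : Addr} {v : Value}
    (htag : tag = .U) (hs : ConfigTyped G I Φ A? s ρ l) :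
    ExprTyped G I Φ A? tag e β → EvalExpr (.U s) ρ l e v → MapTyped v (.base β)
  | .int hn, h => by cases h; exact .base (.int hn)
  | .bool, h => by cases h; exact .base .bool
  | .ref hr, h => by
    cases h with
    | ref h => exact valueTyped_map_iff.1 (hr.valueTyped_of_eval htag hs.no_assumption h)
  | .addr hr, h => by
    cases h with
    | addr h =>
      cases hr.valueTyped_of_eval htag hs.no_assumption h with | contract => exact .base .addr
  | .iop _ _ _ hvalid, h => hvalid.mapTyped_of_eval hs h
  | .numConv (ι₂ := ι₂) he hvalid, h => by
    by_cases hι : ι₂ = .unbounded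
    · subst hι
      rcases he.mapTyped_of_eval htag hs h with ⟨_ | _ | _⟩
      exact .base (.int trivial)
    · exact (hvalid hι).mapTyped_of_eval hs h
  | .ite _ h₂ h₃, h => by
    cases h with
    | iteTrue _ h => exact h₂.mapTyped_of_eval htag hs h
    | iteFalse _ h => exact h₃.mapTyped_of_eval htag hs h
  | .range .., h | .bop .., h | .not .., h | .cmp .., h | .eq .., h => by
    cases h <;> exact .base .bool

end

/-! ### Type safety of mapping expressions -/

theorem IntType.inRange_zero : ∀ ι : IntType, ι.InRange 0
  | .uint M => ⟨le_rfl, sub_nonneg.2 (one_le_pow₀ one_le_two)⟩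
  | .sint M => ⟨neg_nonpos.2 (by positivity), sub_nonneg.2 (one_le_pow₀ one_le_two)⟩
  | .unbounded => trivial

theorem BaseTyped.inMeta {b : BaseValue} {β : BaseType} (h : BaseTyped b β) : b.InMeta β := by
  cases h <;> trivial

theorem Value.isMap_ofFun (β : BaseType) (f : BaseValue → Value) : (Value.ofFun β f).IsMap β := by
  cases β <;> trivial

theorem Value.app_ofFun {β : BaseType} {b : BaseValue} (f : BaseValue → Value)
    (hb : b.InMeta β) : (Value.ofFun β f).app b = some (f b) := by
  cases β <;> cases b <;> first | rfl | cases hb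

theorem Value.IsMap.exists_app {β : BaseType} {f : Value} {b : BaseValue} (hf : f.IsMap β)
    (hb : b.InMeta β) : ∃ u, f.app b = some u := by
  cases β <;> cases f <;> first | exact hf.elim | cases b <;> first | exact hb.elim | exact ⟨_, rfl⟩

theorem mapTyped_ofFun {β : BaseType} {f : BaseValue → Value}
    (h : ∀ b, BaseTyped b β → MapTyped (f b) μ) : MapTyped (.ofFun β f) (.mapping β μ) := by
  refine .mapping (Value.isMap_ofFun β f) fun b u hb hu => ?_
  cases (Value.app_ofFun f hb.inMeta).symm.trans hu
  exact h b hb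

theorem mapTyped_defaultValue : ∀ μ, MapTyped (defaultValue μ) μ
  | .base (.int ι) => .base (.int ι.inRange_zero)
  | .base .bool => .base .bool
  | .base .address => .base .addr
  | .mapping _ μ => mapTyped_ofFun fun _ _ => mapTyped_defaultValue μ

theorem EvalEntries.exists_evalMap {st : TState} {kvs : List (Expr × MapExpr)}
    {us : List (BaseValue × Value)} {p : BaseValue × Value} (h : EvalEntries st ρ l kvs us)
    (hp : p ∈ us) : ∃ q ∈ kvs, EvalMap st ρ l q.2 p.2 := by
  induction kvs generalizing us with
  | nil =>
    cases h
    cases hp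
  | cons q kvs ih =>
    cases h with
    | cons _ hm hr =>
      rcases List.mem_cons.1 hp with rfl | hp
      · exact ⟨_, List.mem_cons_self, hm⟩
      · obtain ⟨q', hq', hv⟩ := ih hr hp
        exact ⟨q', List.mem_cons_of_mem _ hq', hv⟩

theorem EvalEntries.mapTyped_getD {st : TState} {kvs : List (Expr × MapExpr)}
    {us : List (BaseValue × Value)} (h : EvalEntries st ρ l kvs us)
    (hkvs : ∀ q ∈ kvs, ∀ {u}, EvalMap st ρ l q.2 u → MapTyped u μ) (b : BaseValue)
    (hv : MapTyped v μ) : MapTyped ((us.lookup b).getD v) μ := by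
  cases hb : us.lookup b with
  | none => exact hv
  | some u =>
    obtain ⟨q, hq, hu⟩ := h.exists_evalMap (mem_of_lookup_eq_some hb)
    exact hkvs q hq hu

theorem MapExprTyped.mapTyped_of_eval {m : MapExpr} (hs : ConfigTyped G I Φ A? s ρ l)
    (hm : MapExprTyped G I Φ A? m μ) (h : EvalMap (.U s) ρ l m v) : MapTyped v μ := by
  induction hm generalizing v with
  | exp he => cases h with | exp h => exact he.mapTyped_of_eval rfl hs h
  | map _ _ ih =>
    cases h with
    | map h => exact mapTyped_ofFun fun b _ => h.mapTyped_getD ih b (mapTyped_defaultValue _)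
  | upd hr _ _ ih =>
    cases h with
    | upd hf _ h _ hg =>
      cases valueTyped_map_iff.1 (hr.valueTyped_of_eval rfl hs.no_assumption hf) with
      | mapping hmap happ =>
        refine mapTyped_ofFun fun b hb => ?_
        obtain ⟨u, hu⟩ := hmap.exists_app hb.inMeta
        rw [hg b u hu]
        exact h.mapTyped_getD ih b (happ b u hb hu)

/-! ### Slot expressions only allocate -/

mutual

theorem EvalSlot.extends {s s' : State} {ρ : Env} {l : Addr} {se : SlotExpr} {v : Value} :
    EvalSlot G s ρ l se v s' → State.Extends s s'
  | .map _ | .ref _ => .refl s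
  | .addr h => h.extends
  | .new _ _ _ h _ h' => h.extends.trans h'.extends
  | .newPayable _ _ _ h hval _ h' => (h.extends.trans hval.extends).trans h'.extends

theorem EvalSlots.extends {s s' : State} {ρ : Env} {l : Addr} {ses : List SlotExpr}
    {vs : List Value} : EvalSlots G s ρ l ses vs s' → State.Extends s s'
  | .nil => .refl s
  | .cons h hs => h.extends.trans hs.extends

theorem EvalCreates.extends {s s' : State} {ρ : Env} {cs : List Create} {A : Ident} {l : Addr} :
    EvalCreates G s ρ cs A l s' → State.Extends s s'
  | .mk h => h.extends.trans (State.extends_insert_fresh _ _)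

theorem EvalCtorCases.extends {s s' : State} {ρ : Env} {cases : List CtorCase} {A : Ident}
    {l : Addr} : EvalCtorCases G s ρ cases A l s' → State.Extends s s'
  | .mk _ _ _ h => h.extends

end

/-! ### Independence of the state typing -/

theorem forall₂_slotTyped_of_zip {I' : Iface} {ses : List SlotExpr}
    (hn : I'.length = ses.length)
    (h : ∀ p ∈ ses.zip I', SlotTyped G I Φ A? p.1 p.2.2.toSlot) :
    List.Forall₂ (SlotTyped G I Φ A?) ses (I'.map fun p => p.2.toSlot) := by
  rw [List.forall₂_map_right_iff, List.forall₂_iff_zip]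
  exact ⟨hn.symm, fun hp => h _ hp⟩

theorem CreatesTyped.forall₂_slotTyped {cs : List Create} (h : CreatesTyped G I Φ cs C) :
    List.Forall₂ (SlotTyped G I Φ none) (cs.map Create.rhs) (cs.map Create.type) :=
  forall₂_map_map h.2.2.2

mutual

theorem EvalSlot.transfer {G G₁ G₂ : StateTyping} {I : Iface} {Φ : Expr} {A? : Option Ident}
    {s s' : State} {ρ : Env} {l : Addr} {se : SlotExpr} {v : Value} {σ : SlotType}
    (hG : WellTyped G) (h₁ : G.Sub G₁) (h₂ : G.Sub G₂) :
    EvalSlot G₁ s ρ l se v s' → SlotTyped G I Φ A? se σ → EvalSlot G₂ s ρ l se v s'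
  | .map h, _ => .map h
  | .ref h, _ => .ref h
  | .addr h, hse => by cases hse with | addr hse => exact .addr (h.transfer hG h₁ h₂ hse)
  | .new hc hp hn h ho h', hse => by
    cases hse with
    | new hc' _ _ hses =>
      cases hc.symm.trans (h₁.2.1 _ _ hc')
      exact .new (h₂.2.1 _ _ hc') hp hn
        (h.transfer hG h₁ h₂ (forall₂_slotTyped_of_zip hn hses)) ho (h'.transfer hG h₁ h₂ hc' rfl)
  | .newPayable hc hp hn h hval ho h', hse => by
    cases hse with
    | newPayable hc' _ _ hses hw =>
      cases hc.symm.trans (h₁.2.1 _ _ hc')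
      exact .newPayable (h₂.2.1 _ _ hc') hp hn
        (h.transfer hG h₁ h₂ (forall₂_slotTyped_of_zip hn hses)) (hval.transfer hG h₁ h₂ hw) ho
        (h'.transfer hG h₁ h₂ hc' rfl)

theorem EvalSlots.transfer {G G₁ G₂ : StateTyping} {I : Iface} {Φ : Expr} {A? : Option Ident}
    {s s' : State} {ρ : Env} {l : Addr} {ses : List SlotExpr} {vs : List Value}
    {σs : List SlotType} (hG : WellTyped G) (h₁ : G.Sub G₁) (h₂ : G.Sub G₂) :
    EvalSlots G₁ s ρ l ses vs s' → List.Forall₂ (SlotTyped G I Φ A?) ses σs →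
      EvalSlots G₂ s ρ l ses vs s'
  | .nil, _ => .nil
  | .cons h hs, .cons hse hses => .cons (h.transfer hG h₁ h₂ hse) (hs.transfer hG h₁ h₂ hses)

theorem EvalCreates.transfer {G G₁ G₂ : StateTyping} {I : Iface} {Φ : Expr} {C : Storage}
    {s s' : State} {ρ : Env} {cs : List Create} {A : Ident} {l : Addr} (hG : WellTyped G)
    (h₁ : G.Sub G₁) (h₂ : G.Sub G₂) :
    EvalCreates G₁ s ρ cs A l s' → CreatesTyped G I Φ cs C → EvalCreates G₂ s ρ cs A l s'
  | .mk h, hcs => .mk (h.transfer hG h₁ h₂ hcs.forall₂_slotTyped)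

theorem EvalCtorCases.transfer {G G₁ G₂ : StateTyping} {s s' : State} {ρ : Env}
    {cases : List CtorCase} {A : Ident} {l : Addr} {c : Constructor} (hG : WellTyped G)
    (h₁ : G.Sub G₁) (h₂ : G.Sub G₂) :
    EvalCtorCases G₁ s ρ cases A l s' → G.cnstr A = some c → c.cases = cases →
      EvalCtorCases G₂ s ρ cases A l s'
  | .mk hj htrue hfalse h, hc, hcases => by
    subst hcases
    obtain ⟨G', C, hG', hs, -, hctor⟩ := hG.exists_ctorTyped hc
    exact .mk hj htrue hfalse
      (h.transfer hG' (hs.trans h₁) (hs.trans h₂) (hctor.creates _ (List.mem_of_getElem? hj)))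

end

/-! ### Type safety of slot expressions -/

theorem callEnv_typed {bs : List BaseValue} {c o w : BaseValue}
    (hbs : List.Forall₂ (ValueTyped G s) (bs.map .base) (I.map fun p => p.2.toSlot))
    (hc : BaseTyped c .address) (ho : BaseTyped o .address) (hw : BaseTyped w .uint256) :
    EnvTyped G s (callEnv I bs c o w) I := by
  have hargs (x : Ident) : Option.Rel (fun b α => ValueTyped G s (.base b) (ABIType.toSlot α))
      (assign (I.map Prod.fst) bs x) (I.lookup x) := by
    rw [lookup_eq_assign]
    refine optionRel_assign ?_ _ x
    simpa only [List.forall₂_map_left_iff, List.forall₂_map_right_iff] using hbs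
  exact ⟨fun x => (optionRel_iff.1 (hargs x)).1, fun x => (optionRel_iff.1 (hargs x)).2,
    ⟨c, rfl, hc⟩, ⟨o, rfl, ho⟩, ⟨w, rfl, hw⟩⟩

theorem ValidIffs.eval_pre {sₙ sₘ : State} {ses : List SlotExpr} {bs : List BaseValue}
    {I' : Iface} {pre : List Expr} (hvalid : ValidIffs G I Φ A? ses I' pre)
    (hs : ConfigTyped G I Φ A? s ρ l) (h : EvalSlots G s ρ l ses (bs.map .base) sₙ)
    (hext : State.Extends sₙ sₘ) (c o w : BaseValue) {e : Expr} (he : e ∈ pre) :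
    EvalExpr (.U sₘ) (callEnv I' bs c o w) noLoc e (.bool true) :=
  (hvalid s ρ l bs sₙ hs.env hs.loc hs.assumption h e he).extend (.U hext)
    (Env.extends_argEnv_callEnv I' bs c o w)

mutual

theorem EvalSlot.valueTyped {G G' : StateTyping} {I : Iface} {Φ : Expr} {A? : Option Ident}
    {s s' : State} {ρ : Env} {l : Addr} {se : SlotExpr} {v : Value} {σ : SlotType}
    (hG' : WellTyped G') (hsub : G'.Sub G) (hs : ConfigTyped G' I Φ A? s ρ l) :
    EvalSlot G s ρ l se v s' → SlotTyped G' I Φ A? se σ → ValueTyped G' s' v σ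
  | .map h, hse => by cases hse with | map hm => exact .map (hm.mapTyped_of_eval hs h)
  | .ref h, hse => by
    cases hse with | ref hr => exact hr.valueTyped_of_eval rfl hs.no_assumption h
  | .addr h, hse => by
    cases hse with | addr hse => exact valueTyped_contract_iff.1 (h.valueTyped hG' hsub hs hse)
  | .new hc _ hn h ho h', hse => by
    cases hse with
    | new hc' _ _ hz hpre =>
      cases hc.symm.trans (hsub.2.1 _ _ hc')
      have hses := forall₂_slotTyped_of_zip hn hz
      have hargs := h.valueTyped hG' hsub hs hses
      have heval := h.transfer hG' hsub (.refl G') hses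
      exact h'.valueTyped hG' hsub hc' rfl
        (callEnv_typed hargs .addr (hs.env.of_origin ho) (.int (IntType.inRange_zero _)))
        fun _ => hpre.eval_pre hs heval (.refl _) _ _ _
  | .newPayable hc _ hn h hval ho h', hse => by
    cases hse with
    | newPayable hc' _ _ hz hw hpre =>
      cases hc.symm.trans (hsub.2.1 _ _ hc')
      have hses := forall₂_slotTyped_of_zip hn hz
      have hargs := h.valueTyped hG' hsub hs hses
      have heval := h.transfer hG' hsub (.refl G') hses
      cases valueTyped_map_iff.1 (hval.valueTyped hG' hsub (hs.extend h.extends) hw) with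
      | base hw =>
        exact h'.valueTyped hG' hsub hc' rfl
          (callEnv_typed (hargs.imp fun _ _ hv => hv.extend hval.extends) .addr
            (hs.env.of_origin ho) hw)
          fun _ => hpre.eval_pre hs heval hval.extends _ _ _

theorem EvalSlots.valueTyped {G G' : StateTyping} {I : Iface} {Φ : Expr} {A? : Option Ident}
    {s s' : State} {ρ : Env} {l : Addr} {ses : List SlotExpr} {vs : List Value}
    {σs : List SlotType} (hG' : WellTyped G') (hsub : G'.Sub G)
    (hs : ConfigTyped G' I Φ A? s ρ l) :
    EvalSlots G s ρ l ses vs s' → List.Forall₂ (SlotTyped G' I Φ A?) ses σs →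
      List.Forall₂ (ValueTyped G' s') vs σs
  | .nil, .nil => .nil
  | .cons h hs', .cons hse hses =>
    .cons ((h.valueTyped hG' hsub hs hse).extend hs'.extends)
      (hs'.valueTyped hG' hsub (hs.extend h.extends) hses)

theorem EvalCreates.objTyped {G G' : StateTyping} {I : Iface} {Φ : Expr} {C : Storage}
    {s s' : State} {ρ : Env} {cs : List Create} {A : Ident} {l : Addr} (hG' : WellTyped G')
    (hsub : G'.Sub G) (hs : ConfigTyped G' I Φ none s ρ noLoc) :
    EvalCreates G s ρ cs A l s' → CreatesTyped G' I Φ cs C →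
      ∃ o, s'.lookup l = some o ∧ ObjTyped G' s' o A C
  | .mk h, hcs => by
    have hfields := h.valueTyped hG' hsub hs hcs.forall₂_slotTyped
    obtain ⟨-, rfl, -, -⟩ := hcs
    refine ⟨_, Finmap.lookup_insert _, rfl, optionRel_assign (hfields.imp fun _ _ hv => ?_) _⟩
    exact hv.extend (State.extends_insert_fresh _ _)

theorem EvalCtorCases.valueTyped {G G' : StateTyping} {s s' : State} {ρ : Env}
    {cases : List CtorCase} {A : Ident} {l : Addr} {c : Constructor} (hG' : WellTyped G')
    (hsub : G'.Sub G) :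
    EvalCtorCases G s ρ cases A l s' → G'.cnstr A = some c → c.cases = cases →
      EnvTyped G' s ρ c.iface → (∀ e ∈ c.pre, EvalExpr (.U s) ρ noLoc e (.bool true)) →
      ValueTyped G' s' (.base (.addr l)) (.contract A)
  | .mk hj hcond _ h, hc, hcases, hρ, hpre => by
    subst hcases
    obtain ⟨G'', C, hG'', hs, hC, hctor⟩ := hG'.exists_ctorTyped hc
    have hconfig : ConfigTyped G'' c.iface _ none _ _ noLoc :=
      ⟨hρ.restrict hG'' hs hctor.iface, trivial, hcond.and_true (.conj_true hpre)⟩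
    obtain ⟨o, ho, hobj⟩ :=
      h.objTyped hG'' (hs.trans hsub) hconfig (hctor.creates _ (List.mem_of_getElem? hj))
    exact valueTyped_contract_iff.2 (valueTyped_contractAddr_iff.2
      ⟨l, o, C, rfl, ho, hC, hobj.imp fun _ _ _ _ hv => hv.mono hs⟩)

end

/-! ### Persistence along steps -/

/-- Going from `s` to `s'` loses neither typings of values nor addresses: the conclusion of state
transition type safety for one pair of states. -/
def Persists (G : StateTyping) (s s' : State) : Prop :=
  (∀ v σ, ValueTyped G s v σ → ValueTyped G s' v σ) ∧ s.keys ⊆ s'.keys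

theorem Persists.refl (G : StateTyping) (s : State) : Persists G s s := ⟨fun _ _ h => h, subset_rfl⟩

theorem Persists.trans {s₁ s₂ s₃ : State} (h : Persists G s₁ s₂) (h' : Persists G s₂ s₃) :
    Persists G s₁ s₃ :=
  ⟨fun v σ hv => h'.1 v σ (h.1 v σ hv), h.2.trans h'.2⟩

theorem State.Extends.persists (h : State.Extends s s') (G : StateTyping) : Persists G s s' :=
  ⟨fun _ _ hv => hv.extend h, h.keys_subset⟩

theorem Persists.configTyped (h : Persists G s s')
    (hs : ConfigTyped G I (.bool true) (some A) s ρ l) :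
    ConfigTyped G I (.bool true) (some A) s' ρ l :=
  ⟨hs.env.imp fun _ _ _ _ hv => h.1 _ _ hv, h.1 _ _ hs.loc, .bool⟩

theorem persists_setField {o : Obj} (hG : WellTyped G)
    (hl : ValueTyped G s (.base (.addr l)) (.contract A)) (hC : G.storage A = some C)
    (hx : C x = some σ) (hv : ValueTyped G s v σ) (ho : s.lookup l = some o) :
    Persists G s (setField s l o x v) := by
  refine ⟨fun u τ => .of_objTyped hG fun l' o' B D ho' hD hobj => ?_, fun l' hl' => ?_⟩
  · by_cases hl' : l' = l
    · subst hl'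
      cases ho.symm.trans ho'
      cases (hl.objTyped hC ho).type_eq.symm.trans hobj.type_eq
      cases hC.symm.trans hD
      exact ⟨_, Finmap.lookup_insert _, hobj.update hx hv⟩
    · exact ⟨o', (Finmap.lookup_insert_of_ne _ hl').trans ho', hobj⟩
  · rw [Finmap.mem_keys] at hl' ⊢
    exact Finmap.mem_insert.2 (.inr hl')

theorem Ins.persists {r : Ref} (hG : WellTyped G) (hsub : G'.Sub G)
    (hs : ConfigTyped G' I (.bool true) (some A) s ρ l) (hr : RefTyped G' I .S (some A) .U r σ)
    (hv : ValueTyped G' s v σ) (h : Ins s ρ l r v s') : Persists G s s' := by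
  cases h with
  | storage ho _ =>
    cases hr with
    | storage hC hx =>
      exact persists_setField hG (ValueTyped.mono hsub hs.loc) (hsub.1 _ _ hC) hx (hv.mono hsub) ho
  | field h ho _ =>
    cases hr with
    | field hr hC hx =>
      have hl' := hr.valueTyped_of_eval rfl hs h
      exact persists_setField hG (hl'.mono hsub) (hsub.1 _ _ hC) hx (hv.mono hsub) ho

theorem InsAll.persists {us : List Update} {vs : List Value} (hG : WellTyped G)
    (hG' : WellTyped G') (hsub : G'.Sub G) (hs : ConfigTyped G' I (.bool true) (some A) s ρ l)
    (hus : ∀ u ∈ us, RefTyped G' I .S (some A) .U u.ref u.type)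
    (hvs : List.Forall₂ (ValueTyped G' s) vs (us.map Update.type))
    (h : InsAll s ρ l (us.map Update.ref) vs s') : Persists G s s' := by
  induction us generalizing s vs with
  | nil =>
    cases h
    exact .refl G _
  | cons u us ih =>
    rw [List.forall_mem_cons] at hus
    cases hvs with
    | cons hv hvs =>
      cases h with
      | cons h hins =>
        have hpers : Persists G' s _ := h.persists hG' (.refl G') hs hus.1 hv
        exact (h.persists hG hsub hs hus.1 hv).trans
          (ih (hpers.configTyped hs) hus.2 (hvs.imp (hpers.1 · ·)) hins)

theorem RefTyped.declared {G : StateTyping} {I : Iface} {A : Ident} {r : Ref} {σ : SlotType} :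
    RefTyped G I .S (some A) .U r σ → ∃ C, G.storage A = some C
  | .storage hC _ _ => ⟨_, hC⟩
  | .field hr _ _ => hr.declared

theorem EvalUpdates.persists {us : List Update} (hG : WellTyped G) (hG' : WellTyped G')
    (hsub : G'.Sub G) (hl : ValueTyped G s (.base (.addr l)) (.contract A))
    (hρ : EnvTyped G' s ρ I) (hΦ : EvalExpr (.U s) ρ l Φ (.bool true))
    (hus : ∀ u ∈ us, UpdateTyped G' I Φ A u) (h : EvalUpdates G s ρ l us s') :
    Persists G s s' := by
  obtain ⟨vs, sₙ, hslots, hins⟩ := h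
  by_cases hA : ∃ C, G'.storage A = some C
  · have hs : ConfigTyped G' I Φ (some A) s ρ l :=
      ⟨hρ, hl.restrict hG' hsub (SlotType.wf_contract_iff.2 hA), hΦ⟩
    have hvs := hslots.valueTyped hG' hsub hs (forall₂_map_map fun u hu => (hus u hu).2)
    exact (hslots.extends.persists G).trans (hins.persists hG hG' hsub
      (hs.extend hslots.extends).no_assumption (fun u hu => (hus u hu).1) hvs)
  · -- Without updates, nothing forces `A` to be declared in the smaller typing `G'`.
    obtain rfl : us = [] :=
      List.eq_nil_iff_forall_not_mem.2 fun u hu => hA (hus u hu).1.declared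
    cases hslots
    cases hins
    exact .refl G s

theorem StepTrans.persists (hG : WellTyped G) (h : StepTrans G A l s s') : Persists G s s' := by
  obtain ⟨ρ, ts, t, v, hl, hts, ht, hρ, hpre, j, k, hk, hcond, -, hupdates, -⟩ := h
  obtain ⟨G', hG', hsub, htyped⟩ := hG.exists_transTyped hts
  have htrans := htyped t ht
  exact hupdates.persists hG hG' hsub hl (hρ.restrict hG' hsub htrans.iface)
    (hcond.and_true (.conj_true hpre)) (htrans.updates k (List.mem_of_getElem? hk)).1

theorem StepCnstr.extends (h : StepCnstr G A l s s') : State.Extends s s' := by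
  obtain ⟨ρ, c, -, -, -, h⟩ := h
  exact h.extends

theorem Step.persists (hG : WellTyped G) (h : Step G s s') : Persists G s s' := by
  rcases h with ⟨A, l, h⟩ | ⟨A, l, h⟩
  · exact h.extends.persists G
  · exact h.persists hG

end Act

theorem mainTheorem2 (G : Act.StateTyping) (hG : Act.WellTyped G) (s s' : Act.State)
    (h : Act.Steps G s s') :
    (∀ (v : Act.Value) (σ : Act.SlotType), Act.ValueTyped G s v σ → Act.ValueTyped G s' v σ) ∧
      s.keys ⊆ s'.keys := by
  induction h with
  | refl => exact Act.Persists.refl G s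
  | tail _ h ih => exact Act.Persists.trans ih (h.persists hG)
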